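/- There are $n$ agents and $m$ indivisible items. Agent $i$ has utility $u_i(j)\in[0,1]$ for item $j$, and utilities are additive: $u_i(S)=\sum_{j\in S}u_i(j)$. An allocation is a partition of all items into $n$ (possibly empty) bundles $(M_1,\dots,M_n)$, agent $i$ receiving $M_i$; it is envy-free if $u_i(M_i)\ge u_i(M_k)$ for all agents $i,k$. In the round-robin algorithm the agents pick in the order $1,2,\dots,n,1,2,\dots$ until the items run out, each time taking a favourite item (ties broken arbitrarily) among the remaining ones. All utilities $u_i(j)$ are drawn independently from one distribution $\mathcal D$ on $[0,1]$ that is $(\alpha,\beta)$-PDF-bounded, i.e. has a density $f$ with $\alpha\le f(x)\le\beta$ for all $x\in[0,1]$. The distribution $\mathcal D$ is fixed while $n\to\infty$, and $m=m(n)$ may be any sequence of non-negative integers satisfying the stated conditions. Logarithms are to base $2$. **Theorem.** Let $\alpha,\beta>0$. 1. There is a constant $C>0$, depending only on $\alpha$ and $\beta$, such that for every $(\alpha,\beta)$-PDF-bounded $\mathcal D$ and every $m=m(n)$ with $m\ge C\,\frac{n\log n}{\log\log n}$ for all large $n$, the probability that the round-robin algorithm outputs an envy-free allocation (whichever way ties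 are broken) tends to $1$ as $n\to\infty$. 2. (Asymptotic tightness when $m$ is not almost divisible by $n$.) For every $\varepsilon>0$ there is a constant $c>0$, depending only on $\alpha,\beta,\varepsilon$, such that for every $(\alpha,\beta)$-PDF-bounded $\mathcal D$ and every $m=m(n)$ satisfying, for all large $n$, both $m\le c\,\frac{n\log n}{\log\log n}$ and that $m-\ell$ is not divisible by $n$ for any integer $\ell$ with $|\ell|\le n^{\varepsilon}$, the probability that an envy-free allocation exists tends to $0$ as $n\to\infty$. -/

import Mathlib

open MeasureTheory Filter Topology

/-- `D` is a probability distribution supported on `[0, 1]` having there a density `f` (with respect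
to Lebesgue measure) with `α ≤ f x ≤ β` for all `x ∈ [0, 1]`; in particular `D` is non-atomic. -/
def IsPDFBounded (α β : ℝ) (D : Measure ℝ) : Prop :=
  IsProbabilityMeasure D ∧
    ∃ f : ℝ → ℝ, Measurable f ∧ (∀ x ∈ Set.Icc (0 : ℝ) 1, α ≤ f x ∧ f x ≤ β) ∧
      D = (volume.restrict (Set.Icc (0 : ℝ) 1)).withDensity (fun x => ENNReal.ofReal (f x))

/-- A utility profile: `u i j` is the utility of agent `i` for item `j`. -/
abbrev UtilityProfile (n m : ℕ) : Type := Fin n → Fin m → ℝ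

/-- An allocation of all `m` items to `n` agents: `A j` is the agent who receives item `j`. Agent
`i`'s bundle is the set of items `j` with `A j = i`, and it may be empty. -/
abbrev Allocation (n m : ℕ) : Type := Fin m → Fin n

/-- Agent `i`'s (additive) utility for the bundle that agent `k` receives under `A`. -/
noncomputable def bundleUtility {n m : ℕ} (u : UtilityProfile n m) (A : Allocation n m)
    (i k : Fin n) : ℝ :=
  ∑ j ∈ Finset.univ.filter (fun j => A j = k), u i j

/-- No agent strictly prefers another agent's bundle to their own. -/
def EnvyFree {n m : ℕ} (u : UtilityProfile n m) (A : Allocation n m) : Prop :=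
  ∀ i k : Fin n, bundleUtility u A i k ≤ bundleUtility u A i i

/-- `A` is a possible output of the round-robin algorithm on the profile `u`. Here `σ t` is the item
picked at time `t = 0, …, m - 1`. It goes to the agent whose turn it is, which is agent `t % n`
(agents are numbered from `0`), and among the items not picked before time `t`, that is the items
`σ s` with `t ≤ s`, it has the largest utility for that agent. Ties may be broken in any way. -/
def IsRoundRobinOutput {n m : ℕ} (u : UtilityProfile n m) (A : Allocation n m) : Prop :=
  ∃ σ : Equiv.Perm (Fin m),
    (∀ t : Fin m, (A (σ t) : ℕ) = (t : ℕ) % n) ∧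
    ∀ t s : Fin m, t ≤ s → u (A (σ t)) (σ s) ≤ u (A (σ t)) (σ t)

theorem exists_greedy_order (k : ℕ) : ∀ (X : Type) [Fintype X], Fintype.card X = k →
    ∀ w : ℕ → X → ℝ, ∃ e : Fin k ≃ X, ∀ t s : Fin k, t ≤ s → w t (e s) ≤ w t (e t) := by
  classical
  induction k with
  | zero =>
    intro X _ hX w
    exact ⟨(Fintype.equivFinOfCardEq hX).symm, fun t => t.elim0⟩
  | succ k ih =>
    intro X _ hX w
    have : Nonempty X := Fintype.card_pos_iff.mp (by omega)
    obtain ⟨a, ha⟩ := Finite.exists_max (w 0)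
    obtain ⟨e, he⟩ := ih {x : X // x ≠ a} (by
      rw [Fintype.card_subtype_compl, hX, Fintype.card_subtype_eq]; rfl)
      (fun t x => w (t + 1) x)
    refine ⟨(finSuccEquiv k).trans ((Equiv.optionCongr e).trans (Equiv.optionSubtypeNe a)), ?_⟩
    intro t s hts
    induction t using Fin.cases with
    | zero => simpa using ha _
    | succ t =>
      induction s using Fin.cases with
      | zero => simp at hts
      | succ s =>
        have := he t s (by simpa using hts)
        simpa using this

/-- The round-robin algorithm always has an output. -/
theorem exists_isRoundRobinOutput {n m : ℕ} (hn : 0 < n) (u : UtilityProfile n m) :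
    ∃ A : Allocation n m, IsRoundRobinOutput u A := by
  obtain ⟨σ, hσ⟩ := exists_greedy_order m (Fin m) (Fintype.card_fin m)
    (fun t => u ⟨t % n, Nat.mod_lt t hn⟩)
  refine ⟨fun j => ⟨(σ.symm j : ℕ) % n, Nat.mod_lt _ hn⟩, σ, fun t => by simp, fun t s hts => ?_⟩
  simpa using hσ t s hts

/-- The law of the utility profile when all utilities are drawn independently from `D`. -/
noncomputable def utilityLaw (D : Measure ℝ) (n m : ℕ) : Measure (UtilityProfile n m) :=
  Measure.pi fun _ : Fin n => Measure.pi fun _ : Fin m => D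

/-- The rate `n log n / log log n` (logarithms to base 2). -/
noncomputable def rate (n : ℕ) : ℝ :=
  (n : ℝ) * Real.logb 2 n / Real.logb 2 (Real.logb 2 n)

/-- For all large `n`, no integer within distance `n ^ ε` of `m n` is divisible by `n`. -/
def AwayFromMultiples (ε : ℝ) (m : ℕ → ℕ) : Prop :=
  ∀ᶠ n : ℕ in atTop, ∀ l : ℤ, |(l : ℝ)| ≤ (n : ℝ) ^ ε → ¬ ((n : ℤ) ∣ (m n : ℤ) - l)

/-- "`m` is not almost divisible by `n`", that is, for every `n ^ o(1)` bound, eventually no `m - l`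
with `l` between `- n ^ o(1)` and `n ^ o(1)` is divisible by `n`, says exactly that `m` stays away
from the multiples of `n` by `n ^ ε` for some constant `ε > 0`. -/
theorem notAlmostDivisible_iff (m : ℕ → ℕ) :
    (∀ g : ℕ → ℝ, Tendsto g atTop (𝓝 0) → ∀ᶠ n : ℕ in atTop, ∀ l : ℤ,
        |(l : ℝ)| ≤ (n : ℝ) ^ g n → ¬ ((n : ℤ) ∣ (m n : ℤ) - l)) ↔
      ∃ ε : ℝ, 0 < ε ∧ AwayFromMultiples ε m := by
  constructor
  · intro h
    by_contra! hc
    have hf : ∀ k : ℕ, ∃ᶠ n : ℕ in atTop, ∃ l : ℤ,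
        |(l : ℝ)| ≤ (n : ℝ) ^ (1 / ((k : ℝ) + 1)) ∧ ((n : ℤ) ∣ (m n : ℤ) - l) := by
      intro k
      have := hc (1 / ((k : ℝ) + 1)) (by positivity)
      unfold AwayFromMultiples at this
      rw [not_eventually] at this
      refine this.mono fun n hn => ?_
      push Not at hn
      exact hn
    obtain ⟨φ, hφ, hl⟩ := extraction_forall_of_frequently hf
    have hinj := hφ.injective
    let g : ℕ → ℝ := Function.extend φ (fun k : ℕ => 1 / ((k : ℝ) + 1)) 0
    have hg : Tendsto g atTop (𝓝 0) := by
      rw [Metric.tendsto_atTop]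
      intro δ hδ
      obtain ⟨K, hK⟩ := exists_nat_one_div_lt hδ
      refine ⟨φ K, fun n hn => ?_⟩
      by_cases hx : ∃ k, φ k = n
      · obtain ⟨k, rfl⟩ := hx
        have hk : K ≤ k := hφ.le_iff_le.mp hn
        simp only [g, hinj.extend_apply, Real.dist_eq, sub_zero]
        rw [abs_of_pos (by positivity)]
        exact (Nat.one_div_le_one_div hk).trans_lt hK
      · simp only [g, Function.extend_apply' _ _ _ hx]
        simpa using hδ
    have := (h g hg)
    obtain ⟨N, hN⟩ := eventually_atTop.mp this
    obtain ⟨l, h1, h2⟩ := hl N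
    refine hN (φ N) hφ.le_apply l ?_ h2
    simpa only [g, hinj.extend_apply] using h1
  · rintro ⟨ε, hε, h⟩ g hg
    filter_upwards [h, hg.eventually (gt_mem_nhds hε), eventually_ge_atTop 1] with n hn hgn h1 l hl
    exact hn l (hl.trans (Real.rpow_le_rpow_of_exponent_le (by exact_mod_cast h1) hgn.le))

/-! Round-robin: an agent never envies a later one. If `k < i`, match `i`'s pick in each round with
`k`'s pick in the next. In `i`'s eyes every difference is nonnegative, and only `k`'s first pick,
worth at most 1, stays unmatched; so it suffices that the differences over the first `T` rounds
total at least 1. Fix the picking order `σ`. The event that `σ` occurs is a product over agents, and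
within it the values to `i` of `k`'s matched picks are constrained only to lie below `i`'s preceding
pick. Once that pick is worth at least 1/2, the conditional density is at most `2β/α`, and an
exponential moment bounds the probability of a total below 1 by `(2eβ/(αT))^T`
(`pi_greedyRow_inter_smallGap_le`). This is at most `n^(-4)` for `T` of order `log n / log log n`.
Distinct orders are almost surely incompatible, so summing over `σ` costs nothing, and a union bound
over pairs of agents finishes.

Nonexistence: let `q = m / n`. As `m` is far from the multiples of `n`, every allocation leaves `L`
agents with at most `q` items each and has `L` disjoint chunks of `q + 1` items, each inside one
bundle. Envy-freeness forbids each of these agents to value a whole chunk above `1 - 1/(q+1)`. These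
are `L²` independent events of probability at least `δ = (α/(q+1))^(q+1)`, so a fixed choice of
agents and chunks survives with probability at most `exp(-δL²)`. A union bound over these choices,
not over whole allocations, costs `exp(O(L q log n))` and wins when `δL` exceeds `q log n` by a
large constant factor (`utilityLaw_exists_envyFree_le`). -/

/-! ### Integrating out coordinates of a product measure -/

theorem lintegral_pi_mul_le_of_update {ι : Type*} [Fintype ι] [DecidableEq ι] {D : Measure ℝ}
    [IsProbabilityMeasure D] {i j : ι} (hij : i ≠ j) {H : (ι → ℝ) → ENNReal} (hH : Measurable H)
    (hHj : ∀ w y, H (Function.update w j y) = H w) {g h : ℝ → ℝ → ENNReal}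
    (hg : Measurable (Function.uncurry g)) (hh : Measurable (Function.uncurry h)) {c : ENNReal}
    (hgh : ∀ x, ∫⁻ y, g x y ∂D ≤ c * ∫⁻ y, h x y ∂D) :
    ∫⁻ w, H w * g (w i) (w j) ∂Measure.pi (fun _ => D) ≤
      c * ∫⁻ w, H w * h (w i) (w j) ∂Measure.pi (fun _ => D) := by
  have hg' : Measurable fun w : ι → ℝ => g (w i) (w j) :=
    hg.comp (f := fun w : ι → ℝ => (w i, w j)) (by fun_prop)
  have hh' : Measurable fun w : ι → ℝ => h (w i) (w j) :=
    hh.comp (f := fun w : ι → ℝ => (w i, w j)) (by fun_prop)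
  rw [← lintegral_const_mul (f := fun w : ι → ℝ => H w * h (w i) (w j)) _ (hH.mul hh')]
  refine lintegral_le_of_lmarginal_le {j} (hH.mul hg') ((hH.mul hh').const_mul c) ?_
  rw [lmarginal_singleton, lmarginal_singleton]
  intro w
  simp only [hHj, Function.update_self, Function.update_of_ne hij]
  have e1 : Measurable (g (w i)) := hg.of_uncurry_left
  have e2 : Measurable (h (w i)) := hh.of_uncurry_left
  rw [lintegral_const_mul _ e1, lintegral_const_mul _ (e2.const_mul _), lintegral_const_mul _ e2]
  calc _ ≤ H w * (c * ∫⁻ y, h (w i) y ∂D) := by gcongr; exact hgh _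
    _ = _ := by ring

/-- The coordinates `b r` are integrated out one at a time. No `a r` is a `b s`, so each factor's
parameter stays frozen meanwhile. This replaces conditioning: with `h` the indicator of `y ≤ x`, the
right-hand integral is the mass of the conditioning event. -/
theorem lintegral_pi_mul_prod_le {ι κ : Type*} [Fintype ι] [DecidableEq ι] {D : Measure ℝ}
    [IsProbabilityMeasure D] {a b : κ → ι} (hb : Function.Injective b) (hab : ∀ r s, a r ≠ b s)
    {g h : ℝ → ℝ → ENNReal} (hg : Measurable (Function.uncurry g))
    (hh : Measurable (Function.uncurry h)) {c : ENNReal}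
    (hgh : ∀ x, ∫⁻ y, g x y ∂D ≤ c * ∫⁻ y, h x y ∂D) (S : Finset κ) :
    ∀ {H : (ι → ℝ) → ENNReal}, Measurable H →
    (∀ r ∈ S, ∀ w y, H (Function.update w (b r) y) = H w) →
    ∫⁻ w, H w * ∏ r ∈ S, g (w (a r)) (w (b r)) ∂Measure.pi (fun _ => D) ≤
      c ^ S.card * ∫⁻ w, H w * ∏ r ∈ S, h (w (a r)) (w (b r)) ∂Measure.pi (fun _ => D) := by
  classical
  have meas {g : ℝ → ℝ → ENNReal} (hg : Measurable (Function.uncurry g)) (i j : ι) :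
      Measurable fun w : ι → ℝ => g (w i) (w j) :=
    hg.comp (f := fun w : ι → ℝ => (w i, w j)) (by fun_prop)
  induction S using Finset.induction_on with
  | empty => simp
  | insert r S hr ih =>
    intro H hH hHb
    have step1 := ih (H := fun w => H w * g (w (a r)) (w (b r))) (hH.mul (meas hg _ _)) (by
      intro s hs w y
      have hsr : b r ≠ b s := fun h => hr (hb h ▸ hs)
      simp only [hHb s (Finset.mem_insert_of_mem hs), Function.update_of_ne (hab r s),
        Function.update_of_ne hsr])
    have step2 := lintegral_pi_mul_le_of_update (D := D) (hab r r)
      (H := fun w => H w * ∏ s ∈ S, h (w (a s)) (w (b s)))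
      (hH.mul (Finset.measurable_prod _ fun s _ => meas hh _ _)) (by
      intro w y
      simp only [hHb r (Finset.mem_insert_self r S)]
      congr 1
      refine Finset.prod_congr rfl fun s hs => ?_
      have hsr : b s ≠ b r := fun h => hr (hb h ▸ hs)
      rw [Function.update_of_ne (hab s r), Function.update_of_ne hsr]) hg hh hgh
    simp only [Finset.prod_insert hr, Finset.card_insert_of_notMem hr, pow_succ]
    calc _ = ∫⁻ w, H w * g (w (a r)) (w (b r)) * ∏ s ∈ S, g (w (a s)) (w (b s))
          ∂Measure.pi (fun _ => D) := by simp only [mul_assoc]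
      _ ≤ _ := step1
      _ = c ^ S.card * ∫⁻ w, H w * (∏ s ∈ S, h (w (a s)) (w (b s))) * g (w (a r)) (w (b r))
          ∂Measure.pi (fun _ => D) := by
        congr 1; exact lintegral_congr fun w => by ring
      _ ≤ c ^ S.card * (c * ∫⁻ w, H w * (∏ s ∈ S, h (w (a s)) (w (b s))) * h (w (a r)) (w (b r))
          ∂Measure.pi (fun _ => D)) := by gcongr
      _ = _ := by rw [mul_assoc]; congr 2; exact lintegral_congr fun w => by ring

/-! ### Consequences of the density bounds -/

namespace IsPDFBounded

variable {α β : ℝ} {D : Measure ℝ}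

theorem le_smul_volume (hD : IsPDFBounded α β D) : D ≤ ENNReal.ofReal β • volume := by
  obtain ⟨_, f, hf, hb, rfl⟩ := hD
  calc _ ≤ (volume.restrict (Set.Icc (0 : ℝ) 1)).withDensity (fun _ => ENNReal.ofReal β) := by
        refine withDensity_mono ?_
        filter_upwards [ae_restrict_mem measurableSet_Icc] with x hx
        exact ENNReal.ofReal_le_ofReal (hb x hx).2
    _ = ENNReal.ofReal β • volume.restrict (Set.Icc (0 : ℝ) 1) := withDensity_const _
    _ ≤ _ := by gcongr; exact Measure.restrict_le_self

theorem smul_volume_le (hD : IsPDFBounded α β D) :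
    ENNReal.ofReal α • volume.restrict (Set.Icc (0 : ℝ) 1) ≤ D := by
  obtain ⟨_, f, hf, hb, rfl⟩ := hD
  rw [← withDensity_const]
  refine withDensity_mono ?_
  filter_upwards [ae_restrict_mem measurableSet_Icc] with x hx
  exact ENNReal.ofReal_le_ofReal (hb x hx).1

theorem ofReal_mul_le (hD : IsPDFBounded α β D) (hα : 0 ≤ α) {s t : ℝ} (hs : 0 ≤ s)
    (ht : t ≤ 1) : ENNReal.ofReal (α * (t - s)) ≤ D (Set.Ioo s t) := by
  have h := hD.smul_volume_le (Set.Ioo s t)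
  rw [Measure.smul_apply, Measure.restrict_apply measurableSet_Ioo, Set.inter_eq_left.2
    (Set.Ioo_subset_Icc_self.trans (Set.Icc_subset_Icc hs ht)), Real.volume_Ioo, smul_eq_mul,
    ← ENNReal.ofReal_mul hα] at h
  exact h

theorem le_one (hD : IsPDFBounded α β D) (hα : 0 ≤ α) : α ≤ 1 := by
  have h := hD.ofReal_mul_le hα (le_refl 0) (le_refl 1)
  have := hD.1
  have := h.trans prob_le_one
  simpa using this

theorem nullSingletonClass (hD : IsPDFBounded α β D) : NullSingletonClass D where
  measure_singleton x := le_antisymm ((hD.le_smul_volume {x}).trans (by simp)) (zero_le)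

theorem ae_mem_Icc (hD : IsPDFBounded α β D) : ∀ᵐ x ∂D, x ∈ Set.Icc (0 : ℝ) 1 := by
  obtain ⟨_, f, hf, hb, rfl⟩ := hD
  exact (withDensity_absolutelyContinuous _ _) (ae_restrict_mem measurableSet_Icc)

theorem lintegral_exp_le (hD : IsPDFBounded α β D) {r : ℝ} (hr : 0 < r) (x : ℝ) :
    ∫⁻ y in Set.Iic x, ENNReal.ofReal (Real.exp (-(r * (x - y)))) ∂D ≤
      ENNReal.ofReal (β / r) := by
  calc _ ≤ ∫⁻ y in Set.Iic x, ENNReal.ofReal (Real.exp (-(r * (x - y))))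
        ∂(ENNReal.ofReal β • volume) := lintegral_mono' (Measure.restrict_mono le_rfl
          hD.le_smul_volume) le_rfl
    _ = ENNReal.ofReal β * ∫⁻ y in Set.Iic x, ENNReal.ofReal (Real.exp (-(r * (x - y)))) := by
        rw [Measure.restrict_smul, lintegral_smul_measure, smul_eq_mul]
    _ = ENNReal.ofReal β * ENNReal.ofReal (1 / r) := by
        have e : (fun y => Real.exp (-(r * (x - y)))) =
            fun y => Real.exp (-(r * x)) * Real.exp (r * y) := by
          ext y; rw [← Real.exp_add]; congr 1; ring
        rw [← ofReal_integral_eq_lintegral_ofReal, e, integral_const_mul, integral_exp_mul_Iic hr,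
          mul_div_assoc', ← Real.exp_add, neg_add_cancel, Real.exp_zero]
        · rw [e]; exact (integrableOn_exp_mul_Iic hr x).const_mul _
        · exact Eventually.of_forall fun _ => (Real.exp_pos _).le
    _ = _ := by rw [← ENNReal.ofReal_mul' (by positivity), mul_one_div]

/-- The normalising constant when a value is conditioned to lie below `x`. -/
theorem half_le_Iic (hD : IsPDFBounded α β D) (hα : 0 ≤ α) {x : ℝ} (hx : 1 / 2 ≤ x) :
    ENNReal.ofReal (α / 2) ≤ D (Set.Iic x) := by
  have h := hD.ofReal_mul_le hα (le_refl 0) (t := 1 / 2) (by norm_num)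
  refine (le_trans (le_of_eq ?_) h).trans (measure_mono fun y hy => ?_)
  · congr 1; ring
  · exact hy.2.le.trans hx

end IsPDFBounded

/-- Utilities within a product of copies of `D` lie in `[0, 1]`. -/
theorem ae_utilityLaw_mem_Icc {α β : ℝ} {D : Measure ℝ} (hD : IsPDFBounded α β D) (n m : ℕ) :
    ∀ᵐ u ∂utilityLaw D n m, ∀ i j, u i j ∈ Set.Icc (0 : ℝ) 1 := by
  have := hD.1
  rw [ae_all_iff]; intro i
  rw [ae_all_iff]; intro j
  have h1 := (measurePreserving_eval (fun _ : Fin n => Measure.pi fun _ : Fin m => D) i)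
  have h2 := (measurePreserving_eval (fun _ : Fin m => D) j)
  exact (h2.comp h1).quasiMeasurePreserving.ae hD.ae_mem_Icc

/-- Integrate coordinate `k` alone: the section of the diagonal is one point, so the comparison
lemma applies with `c = 0`. -/
theorem pi_tie_eq_zero {D : Measure ℝ} [IsProbabilityMeasure D] [NullSingletonClass D] {m : ℕ}
    {j k : Fin m}
    (hjk : j ≠ k) : (Measure.pi fun _ : Fin m => D) {w | w j = w k} = 0 := by
  have hm : MeasurableSet {w : Fin m → ℝ | w j = w k} :=
    measurableSet_eq_fun (measurable_pi_apply j) (measurable_pi_apply k)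
  rw [← lintegral_indicator_one hm, ← nonpos_iff_eq_zero]
  have h := lintegral_pi_mul_le_of_update (D := D) hjk (H := fun _ => 1) measurable_const
    (fun _ _ => rfl) (g := fun x y => {p : ℝ × ℝ | p.1 = p.2}.indicator 1 (x, y))
    (h := fun _ _ => 0) ?_ measurable_const (c := 0) ?_
  · simpa [Set.indicator] using h
  · exact measurable_one.indicator (measurableSet_eq_fun measurable_fst measurable_snd)
  · intro x
    have : (fun y => {p : ℝ × ℝ | p.1 = p.2}.indicator (1 : ℝ × ℝ → ENNReal) (x, y)) =
        ({x} : Set ℝ).indicator 1 := by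
      ext y; simp [Set.indicator, eq_comm]
    rw [this, lintegral_indicator_one (measurableSet_singleton x)]
    simp

theorem ae_utilityLaw_injective {D : Measure ℝ} [IsProbabilityMeasure D] [NullSingletonClass D]
    (n m : ℕ) :
    ∀ᵐ u ∂utilityLaw D n m, ∀ i, Function.Injective (u i) := by
  rw [ae_all_iff]; intro i
  have h1 := (measurePreserving_eval (fun _ : Fin n => Measure.pi fun _ : Fin m => D) i)
  have h2 : ∀ᵐ w ∂(Measure.pi fun _ : Fin m => D), Function.Injective w := by
    have : ∀ᵐ w ∂(Measure.pi fun _ : Fin m => D), ∀ j k, j ≠ k → w j ≠ w k := by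
      rw [ae_all_iff]; intro j
      rw [ae_all_iff]; intro k
      by_cases hjk : j = k
      · simp [hjk]
      · simpa [ae_iff, hjk] using pi_tie_eq_zero hjk
    filter_upwards [this] with w hw j k h
    by_contra hjk
    exact hw j k hjk h
  exact h1.quasiMeasurePreserving.ae h2

/-- Chernoff bound for the number of items of utility at least `1 / 2`. -/
theorem pi_card_le {α β : ℝ} {D : Measure ℝ} (hD : IsPDFBounded α β D) (hα : 0 ≤ α) (m k : ℕ) :
    (Measure.pi fun _ : Fin m => D)
      {w | (Finset.univ.filter fun j => 1 / 2 ≤ w j).card ≤ k} ≤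
      ENNReal.ofReal (Real.exp (k - α / 4 * m)) := by
  classical
  have := hD.1
  -- The product of `φ (w j)` is `exp (-count)`, to which Markov's inequality is applied.
  set φ : ℝ → ENNReal := fun y => if 1 / 2 ≤ y then ENNReal.ofReal (Real.exp (-1)) else 1 with hφ
  have hφm : Measurable φ := Measurable.ite measurableSet_Ici measurable_const measurable_const
  have hφD : ∫⁻ y, φ y ∂D ≤ ENNReal.ofReal (Real.exp (-(α / 4))) := by
    have hI : MeasurableSet (Set.Ici (1 / 2 : ℝ)) := measurableSet_Ici
    have e : φ = fun y => (Set.Ici (1 / 2 : ℝ)).indicator (fun _ => ENNReal.ofReal (Real.exp (-1))) y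
        + (Set.Ici (1 / 2 : ℝ))ᶜ.indicator (fun _ => 1) y := by
      ext y
      rw [hφ]
      by_cases hy : (1 / 2 : ℝ) ≤ y
      · rw [Set.indicator_of_mem (Set.mem_Ici.2 hy),
          Set.indicator_of_notMem (Set.notMem_compl_iff.2 (Set.mem_Ici.2 hy))]
        simp only [hy]
        simp
      · rw [Set.indicator_of_notMem (show y ∉ Set.Ici (1 / 2) from hy),
          Set.indicator_of_mem (show y ∈ (Set.Ici (1 / 2))ᶜ from hy)]
        simp only [hy]
        simp
    rw [e, lintegral_add_left (measurable_const.indicator hI), lintegral_indicator_const hI,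
      lintegral_indicator_const hI.compl, one_mul]
    have hp : α / 2 ≤ D.real (Set.Ici (1 / 2 : ℝ)) := by
      have h := hD.ofReal_mul_le hα (s := 1 / 2) (t := 1) (by norm_num) le_rfl
      have h := h.trans (measure_mono
        (show Set.Ioo (1 / 2 : ℝ) 1 ⊆ Set.Ici (1 / 2) from fun y hy => hy.1.le))
      have := (ENNReal.ofReal_le_iff_le_toReal (measure_ne_top _ _)).1 h
      rw [measureReal_def]; linarith
    rw [← ofReal_measureReal, ← ofReal_measureReal (s := (Set.Ici (1 / 2 : ℝ))ᶜ),
      measureReal_compl hI, probReal_univ, ← ENNReal.ofReal_mul (Real.exp_pos _).le,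
      ← ENNReal.ofReal_add (by positivity) (by simp [measureReal_le_one])]
    refine ENNReal.ofReal_le_ofReal ?_
    have h1 : Real.exp (-1) ≤ 1 / 2 := by
      have := Real.exp_one_gt_two
      rw [Real.exp_neg, one_div]
      exact inv_anti₀ (by norm_num) this.le
    have h2 := Real.add_one_le_exp (-(α / 4))
    nlinarith
  have hprod : ∫⁻ w, ∏ j, φ (w j) ∂(Measure.pi fun _ : Fin m => D) = (∫⁻ y, φ y ∂D) ^ m := by
    have hind := ProbabilityTheory.iIndepFun_pi (μ := fun _ : Fin m => D) (X := fun _ => φ)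
      fun _ => hφm.aemeasurable
    rw [ProbabilityTheory.lintegral_prod_eq_prod_lintegral_of_indepFun Finset.univ _ hind
      fun i => hφm.comp (measurable_pi_apply i)]
    have hj (j : Fin m) : ∫⁻ w, φ (w j) ∂(Measure.pi fun _ : Fin m => D) = ∫⁻ y, φ y ∂D :=
      (measurePreserving_eval (fun _ : Fin m => D) j).lintegral_comp hφm
    simp [hj]
  calc _ ≤ (Measure.pi fun _ : Fin m => D)
        {w | ENNReal.ofReal (Real.exp (-k)) ≤ ∏ j, φ (w j)} := by
        refine measure_mono fun w hw => ?_
        simp only [Set.mem_ofPred_eq] at hw ⊢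
        rw [hφ, Finset.prod_ite, Finset.prod_const, Finset.prod_const_one, mul_one,
          ← ENNReal.ofReal_pow (Real.exp_pos _).le, ← Real.exp_nat_mul]
        refine ENNReal.ofReal_le_ofReal (Real.exp_le_exp.2 ?_)
        have : ((Finset.univ.filter fun j => 1 / 2 ≤ w j).card : ℝ) ≤ k := by exact_mod_cast hw
        linarith
    _ ≤ (∫⁻ w, ∏ j, φ (w j) ∂(Measure.pi fun _ : Fin m => D)) / ENNReal.ofReal (Real.exp (-k)) :=
        meas_ge_le_lintegral_div (Finset.measurable_prod _ fun j _ =>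
          hφm.comp (measurable_pi_apply j)).aemeasurable (by simp [Real.exp_pos])
          ENNReal.ofReal_ne_top
    _ ≤ ENNReal.ofReal (Real.exp (-(α / 4))) ^ m / ENNReal.ofReal (Real.exp (-k)) := by
        rw [hprod]; gcongr
    _ = _ := by
        rw [← ENNReal.ofReal_pow (Real.exp_pos _).le, ← Real.exp_nat_mul,
          ← ENNReal.ofReal_div_of_pos (Real.exp_pos _), ← Real.exp_sub]
        congr 2; ring

/-- If the values `w (b r)` are only conditioned to be below `w (a r)`, they are unlikely to be all
close to `w (a r)`. -/
theorem pi_sum_sub_lt_one_le {α β : ℝ} {D : Measure ℝ} (hD : IsPDFBounded α β D) (hα : 0 < α)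
    (hβ : 0 < β) {ι : Type*} [Fintype ι] [DecidableEq ι] {T : ℕ} (hT : 0 < T) {a b : Fin T → ι}
    (hb : Function.Injective b) (hab : ∀ r s, a r ≠ b s) {P : Set (ι → ℝ)} (hP : MeasurableSet P)
    (hPb : ∀ r w y, Function.update w (b r) y ∈ P ↔ w ∈ P) :
    (Measure.pi fun _ : ι => D)
      {w | (w ∈ P ∧ ∀ r, w (b r) ≤ w (a r)) ∧ ∑ r, (w (a r) - w (b r)) < 1 ∧
        ∀ r, 1 / 2 ≤ w (a r)} ≤
      ENNReal.ofReal ((Real.exp 1 * (2 * β / α) / T) ^ T) *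
        (Measure.pi fun _ : ι => D) {w | w ∈ P ∧ ∀ r, w (b r) ≤ w (a r)} := by
  classical
  have := hD.1
  have hT' : (0 : ℝ) < T := by exact_mod_cast hT
  set ν := Measure.pi fun _ : ι => D
  -- The tilt has rate `T`: gaps of total below 1 give a product above `exp (-T)`, while each factor
  -- has conditional mean `O(1/T)`.
  set e : ℝ → ℝ → ENNReal := fun x y => ENNReal.ofReal (Real.exp (-(T * (x - y))))
  set g : ℝ → ℝ → ENNReal := fun x y => if 1 / 2 ≤ x ∧ y ≤ x then e x y else 0 with hg
  set h : ℝ → ℝ → ENNReal := fun x y => if y ≤ x then 1 else 0 with hh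
  have hgm : Measurable (Function.uncurry g) := by
    refine Measurable.ite (MeasurableSet.inter (s₁ := {p : ℝ × ℝ | 1 / 2 ≤ p.1})
      (s₂ := {p : ℝ × ℝ | p.2 ≤ p.1}) ?_ ?_) ?_ measurable_const
    · exact measurableSet_le measurable_const measurable_fst
    · exact measurableSet_le measurable_snd measurable_fst
    · exact ENNReal.measurable_ofReal.comp (by fun_prop)
  have hhm : Measurable (Function.uncurry h) :=
    Measurable.ite (measurableSet_le measurable_snd measurable_fst) measurable_const
      measurable_const
  -- The numerator is at most `β/T` and the conditioning mass at least `α/2`; the cutoff `1 / 2 ≤ x`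
  -- in `g` secures the latter.
  have hgh (x : ℝ) : ∫⁻ y, g x y ∂D ≤ ENNReal.ofReal (2 * β / α / T) * ∫⁻ y, h x y ∂D := by
    by_cases hx : 1 / 2 ≤ x
    · have e1 : g x = (Set.Iic x).indicator (e x) := by
        ext y; simp only [hg, hx, true_and, Set.indicator, Set.mem_Iic]
      have e2 : h x = (Set.Iic x).indicator 1 := by
        ext y; simp [hh, Set.indicator]
      rw [e1, e2, lintegral_indicator measurableSet_Iic, lintegral_indicator_one measurableSet_Iic]
      calc _ ≤ ENNReal.ofReal (β / T) := hD.lintegral_exp_le hT' x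
        _ = ENNReal.ofReal (2 * β / α / T) * ENNReal.ofReal (α / 2) := by
          rw [← ENNReal.ofReal_mul (by positivity)]; congr 1; field_simp
        _ ≤ _ := by gcongr; exact hD.half_le_Iic hα.le hx
    · have : g x = fun _ => 0 := by ext y; simp only [hg, hx, false_and, if_false]
      simp [this]
  have hPm : Measurable (P.indicator (1 : (ι → ℝ) → ENNReal)) := measurable_one.indicator hP
  have key := lintegral_pi_mul_prod_le hb hab hgm hhm hgh Finset.univ hPm (by
    intro r _ w y
    simp only [Set.indicator, hPb, Pi.one_apply])
  set Q : Set (ι → ℝ) := {w | w ∈ P ∧ ∀ r, w (b r) ≤ w (a r)}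
  have hQm : MeasurableSet Q := by
    refine hP.inter (measurableSet_setOfPred.2 (Measurable.forall fun r =>
      measurableSet_setOfPred.1 ?_))
    exact measurableSet_le (measurable_pi_apply _) (measurable_pi_apply _)
  have hQ : ∫⁻ w, P.indicator 1 w * ∏ r, h (w (a r)) (w (b r)) ∂ν = ν Q := by
    rw [← lintegral_indicator_one hQm]
    refine lintegral_congr fun w => ?_
    by_cases hw : w ∈ P
    · simp [Set.indicator, hw, Q, hh, Finset.prod_ite_zero]
    · simp [hw, Q]
  rw [hQ, Finset.card_univ, Fintype.card_fin] at key
  calc _ ≤ ν {w | ENNReal.ofReal (Real.exp (-T)) ≤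
          P.indicator 1 w * ∏ r, g (w (a r)) (w (b r))} := by
        refine measure_mono fun w ⟨⟨hw1, hw2⟩, hw3, hw4⟩ => ?_
        have : ∏ r, g (w (a r)) (w (b r)) = ∏ r, e (w (a r)) (w (b r)) :=
          Finset.prod_congr rfl fun r _ => by rw [hg]; exact if_pos ⟨hw4 r, hw2 r⟩
        simp only [Set.mem_ofPred_eq, Set.indicator_of_mem hw1, Pi.one_apply, one_mul, this, e]
        rw [← ENNReal.ofReal_prod_of_nonneg fun _ _ => (Real.exp_pos _).le, ← Real.exp_sum,
          Finset.sum_neg_distrib, ← Finset.mul_sum]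
        refine ENNReal.ofReal_le_ofReal (Real.exp_le_exp.2 ?_)
        nlinarith
    _ ≤ (∫⁻ w, P.indicator 1 w * ∏ r, g (w (a r)) (w (b r)) ∂ν) /
          ENNReal.ofReal (Real.exp (-T)) :=
        meas_ge_le_lintegral_div (hPm.mul (Finset.measurable_prod _ fun r _ =>
          hgm.comp (f := fun w : ι → ℝ => (w (a r), w (b r))) (by fun_prop))).aemeasurable
          (by simp [Real.exp_pos]) ENNReal.ofReal_ne_top
    _ ≤ (ENNReal.ofReal (2 * β / α / T) ^ T * ν Q) / ENNReal.ofReal (Real.exp (-T)) := by gcongr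
    _ = _ := by
        rw [mul_comm, mul_div_assoc, mul_comm, ← ENNReal.ofReal_pow (by positivity),
          ← ENNReal.ofReal_div_of_pos (Real.exp_pos _)]
        congr 2
        rw [Real.exp_neg, div_inv_eq_mul, mul_div_assoc (Real.exp 1), mul_pow, ← Real.exp_nat_mul,
          mul_one, mul_comm]

/-! ### One agent's values given the picking order -/

/-- Agent `i`'s part of the condition that `σ` is a picking order of the round-robin algorithm. -/
def greedyRow (n : ℕ) {m : ℕ} (σ : Equiv.Perm (Fin m)) (i : Fin n) : Set (Fin m → ℝ) :=
  {w | ∀ t s : Fin m, (t : ℕ) % n = i → t ≤ s → w (σ s) ≤ w (σ t)}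

theorem measurableSet_greedyRow {n m : ℕ} (σ : Equiv.Perm (Fin m)) (i : Fin n) :
    MeasurableSet (greedyRow n σ i) := by
  simp only [greedyRow, measurableSet_setOfPred]
  refine Measurable.forall fun t => Measurable.forall fun s => Measurable.imp measurable_const
    (Measurable.imp measurable_const (measurableSet_setOfPred.1 ?_))
  exact measurableSet_le (measurable_pi_apply _) (measurable_pi_apply _)

/-- `w (σ (i + r n))` for `r < T` exceeds `w (σ (k + (r + 1) n))` by a total of less than `1`. -/
def smallGap (n T : ℕ) {m : ℕ} (σ : Equiv.Perm (Fin m)) (i k : Fin n) (h : n * (T + 1) ≤ m) :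
    Set (Fin m → ℝ) :=
  {w | ∑ r : Fin T, (w (σ ⟨i + r * n, by nlinarith [i.2, r.2]⟩) -
      w (σ ⟨k + (r + 1) * n, by nlinarith [k.2, r.2]⟩)) < 1 ∧
    ∀ r : Fin T, 1 / 2 ≤ w (σ ⟨i + r * n, by nlinarith [i.2, r.2]⟩)}

/-- The times `tb r` are not turns of `i`, so the values there never serve as upper bounds for
others. Among the bounds on them the one from `ta r` is the tightest. Hence the row event is a
condition `P` free of these coordinates together with one inequality for each. -/
theorem pi_greedyRow_inter_smallGap_le {α β : ℝ} {D : Measure ℝ} (hD : IsPDFBounded α β D)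
    (hα : 0 < α) (hβ : 0 < β) {n m T : ℕ} (hT : 0 < T) (h : n * (T + 1) ≤ m)
    (σ : Equiv.Perm (Fin m)) {i k : Fin n} (hki : k < i) :
    (Measure.pi fun _ : Fin m => D) (greedyRow n σ i ∩ smallGap n T σ i k h) ≤
      ENNReal.ofReal ((Real.exp 1 * (2 * β / α) / T) ^ T) *
        (Measure.pi fun _ : Fin m => D) (greedyRow n σ i) := by
  have hn : 0 < n := i.pos
  have hki' : (k : ℕ) < i := hki
  set ta : Fin T → Fin m := fun r => ⟨i + r * n, by nlinarith [i.2, r.2]⟩ with hta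
  set tb : Fin T → Fin m := fun r => ⟨k + (r + 1) * n, by nlinarith [k.2, r.2]⟩ with htb
  have hta' (r) : (ta r : ℕ) % n = i := by simp [hta, Nat.mod_eq_of_lt i.2]
  have htb' (r) : (tb r : ℕ) % n = k := by simp [htb, Nat.mod_eq_of_lt k.2]
  set P : Set (Fin m → ℝ) := {w | ∀ t s : Fin m, (t : ℕ) % n = i → t ≤ s → (∀ r, s ≠ tb r) →
    w (σ s) ≤ w (σ t)} with hPdef
  have hPm : MeasurableSet P := by
    simp only [hPdef, measurableSet_setOfPred]
    refine Measurable.forall fun t => Measurable.forall fun s => Measurable.imp measurable_const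
      (Measurable.imp measurable_const (Measurable.imp measurable_const
        (measurableSet_setOfPred.1 ?_)))
    exact measurableSet_le (measurable_pi_apply _) (measurable_pi_apply _)
  have hG : greedyRow n σ i = {w | w ∈ P ∧ ∀ r, w (σ (tb r)) ≤ w (σ (ta r))} := by
    ext w
    constructor
    · intro hw
      refine ⟨fun t s h1 h2 _ => hw t s h1 h2, fun r => hw _ _ (hta' r) ?_⟩
      rw [Fin.le_def]; simp only [hta, htb]; nlinarith [i.2]
    · rintro ⟨hw1, hw2⟩ t s h1 h2
      -- As `k < i`, the last turn of `i` before `tb r` is `ta r`; the bound by any earlier turn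
      -- follows through it.
      by_cases hs : ∃ r, s = tb r
      · obtain ⟨r, rfl⟩ := hs
        refine (hw2 r).trans (hw1 t (ta r) h1 ?_ ?_)
        · rw [Fin.le_def] at h2 ⊢
          simp only [hta, htb] at h2 ⊢
          have hd := Nat.div_add_mod t n
          rw [h1] at hd
          have : (t : ℕ) / n < r + 1 := by
            by_contra hc
            push Not at hc
            have := Nat.mul_le_mul_left n hc
            nlinarith
          have := Nat.mul_le_mul_left n (Nat.lt_succ_iff.1 this)
          nlinarith
        · intro r' hr'
          have := hta' r
          rw [hr', htb'] at this
          omega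
      · push Not at hs
        exact hw1 t s h1 h2 hs
  have hinj : Function.Injective fun r => σ (tb r) := by
    intro r s hrs
    have := congrArg Fin.val (σ.injective hrs)
    simp only [htb, add_right_inj] at this
    have := Nat.eq_of_mul_eq_mul_right hn this
    ext; omega
  have hab (r s : Fin T) : σ (ta r) ≠ σ (tb s) := by
    intro hrs
    have h1 := hta' r
    rw [σ.injective hrs, htb'] at h1
    omega
  have key := pi_sum_sub_lt_one_le hD hα hβ hT (a := fun r => σ (ta r)) hinj hab hPm (by
    intro r w y
    simp only [hPdef, Set.mem_ofPred_eq]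
    refine forall_congr' fun t => forall_congr' fun s => imp_congr_right fun h1 =>
      imp_congr_right fun _ => imp_congr_right fun h3 => ?_
    rw [Function.update_of_ne, Function.update_of_ne]
    · intro hc
      rw [σ.injective hc, htb'] at h1
      omega
    · intro hc
      exact h3 r (σ.injective hc))
  rw [← hG] at key
  refine le_trans (measure_mono fun w hw => ?_) key
  refine ⟨?_, hw.2⟩
  have := hw.1
  rwa [hG] at this

/-! ### Comparing bundles round by round -/

/-- The value `w` of the item picked at time `t`, and `0` if the items have run out by then. -/
noncomputable def pickValue {m : ℕ} (w : Fin m → ℝ) (σ : Equiv.Perm (Fin m)) (t : ℕ) : ℝ :=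
  if h : t < m then w (σ ⟨t, h⟩) else 0

theorem pickValue_of_lt {m : ℕ} (w : Fin m → ℝ) (σ : Equiv.Perm (Fin m)) {t : ℕ} (h : t < m) :
    pickValue w σ t = w (σ ⟨t, h⟩) := dif_pos h

theorem pickValue_le {n m : ℕ} {w : Fin m → ℝ} (hw : ∀ j, 0 ≤ w j) {σ : Equiv.Perm (Fin m)}
    {i : Fin n} (hσ : w ∈ greedyRow n σ i) {t s : ℕ} (ht : t % n = i) (hts : t ≤ s) :
    pickValue w σ s ≤ pickValue w σ t := by
  unfold pickValue
  split_ifs with h1 h2 h2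
  · exact hσ _ _ ht hts
  · omega
  · exact hw _
  · exact le_rfl

/-- Padding with zeros gives all agents the same number of rounds. The range `m + 1` is more than
enough and leaves `m` rounds after a shift by one. -/
theorem bundleUtility_eq_sum_pickValue {n m : ℕ} (u : UtilityProfile n m) {A : Allocation n m}
    {σ : Equiv.Perm (Fin m)} (hA : ∀ t : Fin m, (A (σ t) : ℕ) = (t : ℕ) % n) (i k : Fin n) :
    bundleUtility u A i k = ∑ r ∈ Finset.range (m + 1), pickValue (u i) σ (k + r * n) := by
  have hn : 0 < n := k.pos
  unfold bundleUtility
  rw [Finset.sum_filter, ← Equiv.sum_comp σ]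
  have e1 (t : Fin m) : (if A (σ t) = k then u i (σ t) else 0) =
      (fun t : ℕ => if t % n = k then pickValue (u i) σ t else 0) t := by
    simp only [pickValue_of_lt _ _ t.2, Fin.ext_iff, hA]
  simp_rw [e1]
  rw [Fin.sum_univ_eq_sum_range fun t => if t % n = k then pickValue (u i) σ t else 0,
    ← Finset.sum_filter,
    ← Finset.sum_filter_of_ne (s := Finset.range (m + 1)) (p := fun r => k + r * n < m)]
  · refine Finset.sum_nbij' (fun t => t / n) (fun r => k + r * n) ?_ ?_ ?_ ?_ ?_
    · intro t ht
      simp only [Finset.mem_filter, Finset.mem_range] at ht ⊢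
      have := Nat.mod_add_div t n
      rw [ht.2, mul_comm] at this
      have := Nat.div_le_self t n
      exact ⟨by omega, by omega⟩
    · intro r hr
      simp only [Finset.mem_filter, Finset.mem_range] at hr ⊢
      exact ⟨hr.2, by simp [Nat.mod_eq_of_lt k.2]⟩
    · intro t ht
      simp only [Finset.mem_filter, Finset.mem_range] at ht ⊢
      have := Nat.mod_add_div t n
      rw [ht.2, mul_comm] at this
      exact this
    · intro r hr
      simp [Nat.add_mul_div_right _ _ hn, Nat.div_eq_of_lt k.2]
    · intro t ht
      simp only [Finset.mem_filter, Finset.mem_range] at ht ⊢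
      have := Nat.mod_add_div t n
      rw [ht.2, mul_comm] at this
      rw [this]
  · intro r _ hr
    by_contra hc
    exact hr (dif_neg hc)

theorem bundleUtility_le_of_le {n m : ℕ} {u : UtilityProfile n m}
    (hu : ∀ i j, u i j ∈ Set.Icc (0 : ℝ) 1) {A : Allocation n m} {σ : Equiv.Perm (Fin m)}
    (hA : ∀ t : Fin m, (A (σ t) : ℕ) = (t : ℕ) % n) {i k : Fin n} (hσ : u i ∈ greedyRow n σ i)
    (hik : i ≤ k) : bundleUtility u A i k ≤ bundleUtility u A i i := by
  rw [bundleUtility_eq_sum_pickValue u hA, bundleUtility_eq_sum_pickValue u hA]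
  refine Finset.sum_le_sum fun r _ => pickValue_le (fun j => (hu i j).1) hσ ?_ ?_
  · simp [Nat.mod_eq_of_lt i.2]
  · have : (i : ℕ) ≤ k := hik
    omega

/-- Shift `k`'s rounds by one: the first `T` gaps already outweigh `k`'s unmatched first pick, and
the later gaps are nonnegative. -/
theorem bundleUtility_le_of_lt {n m T : ℕ} {u : UtilityProfile n m}
    (hu : ∀ i j, u i j ∈ Set.Icc (0 : ℝ) 1) {A : Allocation n m} {σ : Equiv.Perm (Fin m)}
    (hA : ∀ t : Fin m, (A (σ t) : ℕ) = (t : ℕ) % n) {i k : Fin n} (hσ : u i ∈ greedyRow n σ i)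
    (hki : k < i) (h : n * (T + 1) ≤ m)
    (hhalf : ∀ r : Fin T, 1 / 2 ≤ u i (σ ⟨i + r * n, by nlinarith [i.2, r.2]⟩))
    (hgap : u i ∉ smallGap n T σ i k h) : bundleUtility u A i k ≤ bundleUtility u A i i := by
  have hn : 0 < n := k.pos
  have hki' : (k : ℕ) < i := hki
  have hgap' : 1 ≤ ∑ r ∈ Finset.range T,
      (pickValue (u i) σ (i + r * n) - pickValue (u i) σ (k + (r + 1) * n)) := by
    rw [← Fin.sum_univ_eq_sum_range fun r =>
      pickValue (u i) σ (i + r * n) - pickValue (u i) σ (k + (r + 1) * n)]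
    by_contra hc
    push Not at hc
    refine hgap ⟨lt_of_eq_of_lt (Finset.sum_congr rfl fun r _ => ?_) hc, hhalf⟩
    rw [pickValue_of_lt, pickValue_of_lt]
  have hnn (r : ℕ) : 0 ≤ pickValue (u i) σ (i + r * n) - pickValue (u i) σ (k + (r + 1) * n) := by
    refine sub_nonneg.2 (pickValue_le (fun j => (hu i j).1) hσ ?_ ?_)
    · simp [Nat.mod_eq_of_lt i.2]
    · nlinarith [i.2]
  have hTm : T ≤ m := by nlinarith
  have hsub : ∑ r ∈ Finset.range T,
      (pickValue (u i) σ (i + r * n) - pickValue (u i) σ (k + (r + 1) * n)) ≤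
      ∑ r ∈ Finset.range m,
      (pickValue (u i) σ (i + r * n) - pickValue (u i) σ (k + (r + 1) * n)) :=
    Finset.sum_le_sum_of_subset_of_nonneg (Finset.range_subset_range.2 hTm) fun r _ _ => hnn r
  simp only [Finset.sum_sub_distrib] at hsub hgap'
  rw [bundleUtility_eq_sum_pickValue u hA, bundleUtility_eq_sum_pickValue u hA,
    Finset.sum_range_succ', Finset.sum_range_succ (fun r => pickValue (u i) σ (i + r * n))]
  have hP (t : ℕ) : pickValue (u i) σ t ∈ Set.Icc (0 : ℝ) 1 := by
    unfold pickValue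
    split_ifs
    · exact hu _ _
    · simp
  have h1 := (hP (k + 0 * n)).2
  have h2 := (hP (i + m * n)).1
  linarith

/-- At most `n * T` items are gone by time `t`, so one worth at least 1/2 is still available. -/
theorem half_le_of_card {n m T : ℕ} {w : Fin m → ℝ} {σ : Equiv.Perm (Fin m)} {i : Fin n}
    (hσ : w ∈ greedyRow n σ i)
    (hw : n * T < (Finset.univ.filter fun j => 1 / 2 ≤ w j).card) {t : Fin m}
    (ht : (t : ℕ) % n = i) (htT : (t : ℕ) ≤ n * T) : 1 / 2 ≤ w (σ t) := by
  by_contra hc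
  push Not at hc
  have hsub : (Finset.univ.filter fun j => 1 / 2 ≤ w j) ⊆ (Finset.Iio t).image σ := by
    intro j hj
    simp only [Finset.mem_filter, Finset.mem_univ, true_and] at hj
    refine Finset.mem_image.2 ⟨σ.symm j, ?_, by simp⟩
    rw [Finset.mem_Iio]
    by_contra hlt
    have := hσ t (σ.symm j) ht (not_lt.1 hlt)
    rw [Equiv.apply_symm_apply] at this
    linarith
  have := (Finset.card_le_card hsub).trans Finset.card_image_le
  rw [Fin.card_Iio] at this
  omega

/-! ### Summing over picking orders -/

/-- By strong induction on time: after identical picks both orders choose from the same items, where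
the favourite is unique. -/
theorem eq_of_mem_greedyRow {n m : ℕ} (hn : 0 < n) {u : UtilityProfile n m}
    (hu : ∀ i, Function.Injective (u i)) {σ τ : Equiv.Perm (Fin m)}
    (hσ : ∀ i, u i ∈ greedyRow n σ i) (hτ : ∀ i, u i ∈ greedyRow n τ i) : σ = τ := by
  have later {σ τ : Equiv.Perm (Fin m)} {t : Fin m} (ih : ∀ s < t, σ s = τ s) :
      ∃ s, t ≤ s ∧ σ s = τ t := by
    refine ⟨σ.symm (τ t), ?_, by simp⟩
    by_contra hc
    have h1 := ih _ (not_le.1 hc)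
    rw [Equiv.apply_symm_apply] at h1
    have := τ.injective h1
    rw [← this] at hc
    exact hc le_rfl
  ext1 t
  induction t using WellFoundedLT.induction with
  | ind t ih =>
    obtain ⟨s, hs, hs'⟩ := later ih
    obtain ⟨s', hs1, hs1'⟩ := later fun s hs => (ih s hs).symm
    have h1 := hσ ⟨t % n, Nat.mod_lt _ hn⟩ t s rfl hs
    have h2 := hτ ⟨t % n, Nat.mod_lt _ hn⟩ t s' rfl hs1
    rw [hs'] at h1
    rw [hs1'] at h2
    exact hu _ (le_antisymm h2 h1)

theorem sum_pi_greedyRow_le_one {D : Measure ℝ} [IsProbabilityMeasure D] [NullSingletonClass D]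
    {n : ℕ} (hn : 0 < n) (m : ℕ) :
    ∑ σ : Equiv.Perm (Fin m), utilityLaw D n m (Set.univ.pi fun i => greedyRow n σ i) ≤ 1 := by
  have : IsProbabilityMeasure (utilityLaw D n m) := by unfold utilityLaw; infer_instance
  rw [← measure_biUnion_finset₀]
  · exact prob_le_one
  · intro σ _ τ _ hστ
    refine measure_mono_null (fun u hu => ?_) (ae_iff.1 (ae_utilityLaw_injective (D := D) n m))
    intro hinj
    exact hστ (eq_of_mem_greedyRow hn hinj (fun i => hu.1 i trivial) fun i => hu.2 i trivial)
  · exact fun σ _ =>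
      (MeasurableSet.univ_pi fun i => measurableSet_greedyRow σ i).nullMeasurableSet

theorem utilityLaw_exists_not_envyFree_le {α β : ℝ} {D : Measure ℝ} (hD : IsPDFBounded α β D)
    (hα : 0 < α) (hβ : 0 < β) {n m T : ℕ} (hn : 0 < n) (hT : 0 < T) (h : n * (T + 1) ≤ m) :
    utilityLaw D n m {u | ∀ A : Allocation n m, IsRoundRobinOutput u A → EnvyFree u A}ᶜ ≤
      n * ENNReal.ofReal (Real.exp (n * T - α / 4 * m)) +
        n ^ 2 * ENNReal.ofReal ((Real.exp 1 * (2 * β / α) / T) ^ T) := by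
  classical
  have := hD.1
  have := hD.nullSingletonClass
  set μ := utilityLaw D n m with hμ
  set ν := Measure.pi fun _ : Fin m => D with hν
  set G : Equiv.Perm (Fin m) → Set (UtilityProfile n m) :=
    fun σ => Set.univ.pi fun i => greedyRow n σ i with hG
  set low : Fin n → Set (UtilityProfile n m) :=
    fun i => {u | (Finset.univ.filter fun j => 1 / 2 ≤ u i j).card ≤ n * T} with hlow
  set bad : Equiv.Perm (Fin m) → Fin n × Fin n → Set (UtilityProfile n m) :=
    fun σ p => {u | u ∈ G σ ∧ p.2 < p.1 ∧ u p.1 ∈ smallGap n T σ p.1 p.2 h} with hbad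
  set N : Set (UtilityProfile n m) := {u | ¬ ∀ i j, u i j ∈ Set.Icc (0 : ℝ) 1} with hN
  set η := ENNReal.ofReal ((Real.exp 1 * (2 * β / α) / T) ^ T) with hη
  have hcover : {u | ∀ A : Allocation n m, IsRoundRobinOutput u A → EnvyFree u A}ᶜ ⊆
      N ∪ ((⋃ i, low i) ∪ ⋃ σ, ⋃ p, bad σ p) := by
    intro u hu
    simp only [Set.mem_compl_iff, Set.mem_ofPred_eq, not_forall] at hu
    obtain ⟨A, ⟨σ, hA, hσ⟩, hEF⟩ := hu
    by_contra hc
    simp only [hN, hlow, hbad, Set.mem_union, Set.mem_iUnion, Set.mem_ofPred_eq, not_or,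
      not_exists, not_not, not_and, not_le] at hc
    obtain ⟨hu, hl, hb⟩ := hc
    have hrow (i : Fin n) : u i ∈ greedyRow n σ i := by
      intro t s ht hts
      have : A (σ t) = i := by ext; rw [hA, ht]
      have h := hσ t s hts
      rwa [this] at h
    refine hEF fun i k => ?_
    rcases le_or_gt i k with hik | hki
    · exact bundleUtility_le_of_le hu hA (hrow i) hik
    · refine bundleUtility_le_of_lt hu hA (hrow i) hki h (fun r => ?_)
        (hb σ (i, k) (fun i _ => hrow i) hki)
      refine half_le_of_card (hrow i) (hl i) ?_ ?_
      · simp [Nat.mod_eq_of_lt i.2]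
      · nlinarith [i.2, r.2]
  have hN0 : μ N = 0 := ae_iff.1 (ae_utilityLaw_mem_Icc hD n m)
  have hlowi (i : Fin n) : μ (low i) ≤ ENNReal.ofReal (Real.exp (n * T - α / 4 * m)) := by
    have h1 := (measurePreserving_eval (fun _ : Fin n => ν) i).measure_preimage_le
      {w : Fin m → ℝ | (Finset.univ.filter fun j => 1 / 2 ≤ w j).card ≤ n * T}
    have h2 := pi_card_le hD hα.le m (n * T)
    push_cast at h2
    exact h1.trans h2
  have hbadi (σ : Equiv.Perm (Fin m)) (p : Fin n × Fin n) : μ (bad σ p) ≤ η * μ (G σ) := by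
    obtain ⟨i, k⟩ := p
    by_cases hki : k < i
    · have hsub : bad σ (i, k) ⊆ Set.univ.pi (Function.update (fun i => greedyRow n σ i) i
          (greedyRow n σ i ∩ smallGap n T σ i k h)) := by
        rintro u ⟨h1, _, h2⟩ i' _
        by_cases hi : i' = i
        · subst hi
          rw [Function.update_self]
          exact ⟨h1 i' trivial, h2⟩
        · rw [Function.update_of_ne hi]
          exact h1 i' trivial
      refine (measure_mono hsub).trans ?_
      simp only [hμ, hG, utilityLaw, Measure.pi_pi]
      rw [← Finset.mul_prod_erase Finset.univ _ (Finset.mem_univ i),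
        ← Finset.mul_prod_erase Finset.univ (fun i => (Measure.pi fun _ : Fin m => D)
          (greedyRow n σ i)) (Finset.mem_univ i), Function.update_self, ← mul_assoc]
      refine mul_le_mul' (pi_greedyRow_inter_smallGap_le hD hα hβ hT h σ hki) (le_of_eq ?_)
      refine Finset.prod_congr rfl fun i' hi' => ?_
      rw [Function.update_of_ne (Finset.ne_of_mem_erase hi')]
    · have : bad σ (i, k) = ∅ := by
        ext u; simp [hbad, hki]
      simp [this]
  calc _ ≤ μ N + (μ (⋃ i, low i) + μ (⋃ σ, ⋃ p, bad σ p)) :=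
        (measure_mono hcover).trans ((measure_union_le _ _).trans (by
          gcongr; exact measure_union_le _ _))
    _ ≤ 0 + (∑ i, μ (low i) + ∑ σ, ∑ p, μ (bad σ p)) := by
        rw [hN0]
        gcongr
        · exact measure_iUnion_fintype_le μ _
        · exact (measure_iUnion_fintype_le μ _).trans
            (Finset.sum_le_sum fun σ _ => measure_iUnion_fintype_le μ _)
    _ ≤ 0 + (∑ _i : Fin n, ENNReal.ofReal (Real.exp (n * T - α / 4 * m)) +
          ∑ σ, ∑ _p : Fin n × Fin n, η * μ (G σ)) := by
        gcongr with i _ σ _ p _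
        · exact hlowi i
        · exact hbadi σ p
    _ = n * ENNReal.ofReal (Real.exp (n * T - α / 4 * m)) + n ^ 2 * η * ∑ σ, μ (G σ) := by
        simp [Finset.mul_sum, sq, mul_assoc]
    _ ≤ n * ENNReal.ofReal (Real.exp (n * T - α / 4 * m)) + n ^ 2 * η * 1 := by
        gcongr
        exact sum_pi_greedyRow_le_one hn m
    _ = _ := by rw [mul_one]

/-! ### Asymptotics for round-robin -/

theorem tendsto_logb_two_natCast : Tendsto (fun n : ℕ => Real.logb 2 n) atTop atTop :=
  (Real.tendsto_logb_atTop (by norm_num)).comp tendsto_natCast_atTop_atTop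

theorem eventually_mul_logb_le_rpow (K : ℝ) {s : ℝ} (hs : 0 < s) :
    ∀ᶠ x : ℝ in atTop, K * Real.logb 2 x ≤ x ^ s := by
  have h := (isLittleO_log_rpow_atTop hs).const_mul_left (K / Real.log 2)
  filter_upwards [h.bound one_pos, eventually_ge_atTop 0] with x hx hx0
  rw [one_mul, Real.norm_of_nonneg (Real.rpow_nonneg hx0 _)] at hx
  refine le_trans (le_of_eq ?_) ((le_abs_self _).trans hx)
  rw [Real.logb]; ring

/-- For a suitable number `T` of rounds, `n T` is of order `rate n`, and `(K / T) ^ T` is at most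
`n ^ (-4)`. -/
theorem eventually_exists_rounds {K : ℝ} (hK : 0 < K) :
    ∀ᶠ n : ℕ in atTop, (n : ℝ) ≤ rate n ∧ ∃ T : ℕ, 0 < T ∧ (n : ℝ) * T ≤ 9 * rate n ∧
      (K / T) ^ T ≤ ((n : ℝ) ^ 4)⁻¹ := by
  have hL := tendsto_logb_two_natCast
  filter_upwards [eventually_gt_atTop 0, hL.eventually_gt_atTop 2,
    hL.eventually (eventually_mul_logb_le_rpow (K / 8) (s := 1 / 2) (by norm_num)),
    hL.eventually (eventually_mul_logb_le_rpow 1 (s := 1) (by norm_num))] with n hn h2 hKL h1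
  rw [Real.rpow_one, one_mul] at h1
  have hn' : (0 : ℝ) < n := by exact_mod_cast hn
  set L := Real.logb 2 n with hLdef
  set l := Real.logb 2 L with hl
  have hL0 : 0 < L := by linarith
  have hl0 : 0 < l := Real.logb_pos (by norm_num) (by linarith)
  set q := L / l with hq
  have hq1 : 1 ≤ q := (one_le_div hl0).2 h1
  have hrate : rate n = n * q := by rw [rate, ← hLdef, ← hl, hq]; ring
  have hlog2 : 0 < Real.log 2 := Real.log_pos (by norm_num)
  have hqL : q * Real.log L = Real.log n := by
    have e1 : Real.log L = l * Real.log 2 := by rw [hl, Real.logb]; field_simp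
    have e2 : Real.log n = L * Real.log 2 := by rw [hLdef, Real.logb]; field_simp
    rw [e1, e2, hq]; field_simp
  -- With `T ≥ 8q` and `K / T ≤ L^(-1/2)`, the identity `q log L = log n` yields the exponent `-4
  -- log n`. As `q ≥ 1`, also `T ≤ 9q`.
  have hTl : 8 * q ≤ ⌈8 * q⌉₊ := Nat.le_ceil _
  have hTu : (⌈8 * q⌉₊ : ℝ) < 8 * q + 1 := Nat.ceil_lt_add_one (by positivity)
  set T := ⌈8 * q⌉₊
  have hT0 : (0 : ℝ) < T := by linarith
  refine ⟨by rw [hrate]; nlinarith, T, by exact_mod_cast hT0, by rw [hrate]; nlinarith, ?_⟩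
  have hKT : K / T ≤ Real.exp (-(Real.log L / 2)) := by
    have e : L ^ (1 / 2 : ℝ) = Real.exp (Real.log L / 2) := by
      rw [Real.rpow_def_of_pos hL0]; congr 1; ring
    have hLs : L = L ^ (1 / 2 : ℝ) * L ^ (1 / 2 : ℝ) := by
      rw [← Real.rpow_add hL0]; norm_num
    have hp : 0 < L ^ (1 / 2 : ℝ) := by positivity
    rw [Real.exp_neg, ← e, div_le_iff₀ hT0, inv_mul_eq_div, le_div_iff₀ hp]
    refine le_trans ?_ hTl
    rw [hq, mul_div_assoc', le_div_iff₀ hl0]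
    nlinarith
  calc (K / T) ^ T ≤ Real.exp (-(Real.log L / 2)) ^ T := by gcongr
    _ = Real.exp (-(T * Real.log L / 2)) := by rw [← Real.exp_nat_mul]; congr 1; ring
    _ ≤ Real.exp (-(4 * Real.log n)) := by
        refine Real.exp_le_exp.2 ?_
        have := Real.log_pos (show 1 < L by linarith)
        nlinarith
    _ = _ := by
        rw [Real.exp_neg, mul_comm, Real.exp_mul, Real.exp_log hn']; norm_cast

theorem tendsto_utilityLaw_roundRobin_envyFree {α β : ℝ} (hα : 0 < α) (hβ : 0 < β) {D : Measure ℝ}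
    (hD : IsPDFBounded α β D) {m : ℕ → ℕ} (hm : ∀ᶠ n : ℕ in atTop, 72 / α * rate n ≤ (m n : ℝ)) :
    Tendsto (fun n : ℕ => utilityLaw D n (m n)
      {u | ∀ A : Allocation n (m n), IsRoundRobinOutput u A → EnvyFree u A}) atTop (𝓝 1) := by
  have := hD.1
  have hα1 := hD.le_one hα.le
  have hpr (n) : IsProbabilityMeasure (utilityLaw D n (m n)) := by unfold utilityLaw; infer_instance
  set f : ℕ → ℝ := fun n => n * Real.exp (-n) + ((n : ℝ) ^ 2)⁻¹ with hf
  have hf0 : Tendsto f atTop (𝓝 0) := by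
    have h1 : Tendsto (fun n : ℕ => (n : ℝ) * Real.exp (-n)) atTop (𝓝 0) := by
      have := (Real.tendsto_pow_mul_exp_neg_atTop_nhds_zero 1).comp
        (tendsto_natCast_atTop_atTop (R := ℝ))
      simpa [Function.comp_def] using this
    have h2 : Tendsto (fun n : ℕ => ((n : ℝ) ^ 2)⁻¹) atTop (𝓝 0) :=
      tendsto_inv_atTop_zero.comp ((tendsto_pow_atTop two_ne_zero).comp tendsto_natCast_atTop_atTop)
    simpa using h1.add h2
  have hbound : ∀ᶠ n : ℕ in atTop, utilityLaw D n (m n)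
      {u | ∀ A : Allocation n (m n), IsRoundRobinOutput u A → EnvyFree u A}ᶜ ≤
      ENNReal.ofReal (f n) := by
    filter_upwards [hm, eventually_gt_atTop 0,
      eventually_exists_rounds (K := Real.exp 1 * (2 * β / α)) (by positivity)]
      with n hmn hn ⟨hnr, T, hT, hTn, hKT⟩
    have hn' : (0 : ℝ) < n := by exact_mod_cast hn
    have hm72 : 72 * rate n ≤ m n := by
      refine le_trans ?_ hmn
      have : 72 ≤ 72 / α := by rw [le_div_iff₀ hα]; linarith
      nlinarith
    -- So `α m / 4 ≥ 18 rate n`, while `n T ≤ 9 rate n` and `n ≤ rate n`: the Chernoff exponent is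
    -- at most `-n`.
    have hmα : 72 * rate n ≤ α * m n := by
      have := mul_le_mul_of_nonneg_left hmn hα.le
      rw [← mul_assoc, mul_div_cancel₀ _ hα.ne'] at this
      exact this
    have hm' : n * (T + 1) ≤ m n := by
      have : (n : ℝ) * (T + 1) ≤ m n := by nlinarith
      exact_mod_cast this
    refine (utilityLaw_exists_not_envyFree_le hD hα hβ hn hT hm').trans ?_
    rw [hf, ENNReal.ofReal_add (by positivity) (by positivity), ENNReal.ofReal_mul hn'.le,
      ENNReal.ofReal_natCast]
    gcongr
    · linarith
    · calc (n : ENNReal) ^ 2 * _ ≤ (n : ENNReal) ^ 2 * ENNReal.ofReal (((n : ℝ) ^ 4)⁻¹) := by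
            gcongr
        _ = ENNReal.ofReal ((n : ℝ) ^ 2 * ((n : ℝ) ^ 4)⁻¹) := by
            rw [ENNReal.ofReal_mul (by positivity), ENNReal.ofReal_pow hn'.le,
              ENNReal.ofReal_natCast]
        _ ≤ _ := ENNReal.ofReal_le_ofReal (le_of_eq (by field_simp))
  have hlow : Tendsto (fun n => 1 - ENNReal.ofReal (f n)) atTop (𝓝 1) := by
    have := ENNReal.Tendsto.sub (tendsto_const_nhds (x := (1 : ENNReal)) (f := atTop (α := ℕ)))
      (ENNReal.tendsto_ofReal hf0) (Or.inl ENNReal.one_ne_top)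
    simpa using this
  refine tendsto_of_tendsto_of_tendsto_of_le_of_le' hlow tendsto_const_nhds ?_
    (Eventually.of_forall fun n => prob_le_one)
  filter_upwards [hbound] with n hn
  rw [tsub_le_iff_right]
  calc (1 : ENNReal) = utilityLaw D n (m n) Set.univ := measure_univ.symm
    _ ≤ _ := by
        rw [← Set.union_compl_self {u | ∀ A : Allocation n (m n),
          IsRoundRobinOutput u A → EnvyFree u A}]
        exact (measure_union_le _ _).trans (by gcongr)

/-! ### Nonexistence: small bundles against chunks -/

theorem measurePreserving_pi_comp_injective {ι κ X : Type*} [Fintype ι] [Fintype κ]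
    [MeasurableSpace X] (D : Measure X) [IsProbabilityMeasure D] {φ : κ → ι}
    (hφ : Function.Injective φ) :
    MeasurePreserving (fun (w : ι → X) p => w (φ p)) (Measure.pi fun _ => D)
      (Measure.pi fun _ => D) where
  measurable := by fun_prop
  map_eq := by
    have h := (ProbabilityTheory.iIndepFun_pi (μ := fun _ : ι => D) (X := fun _ x => x)
      fun _ => aemeasurable_id').precomp hφ
    have := h.map_fun_eq_pi_map fun i => (measurable_pi_apply (φ i)).aemeasurable
    rw [show (fun (w : ι → X) p => w (φ p)) = fun ω i =>
      (fun (j : ι) (w : ι → X) => w j) (φ i) ω from rfl]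
    refine this.trans ?_
    congr 1
    ext1 i
    exact (measurePreserving_eval (fun _ : ι => D) (φ i)).map_eq

theorem measurePreserving_pi_curry {ι κ X : Type*} [Fintype ι] [Fintype κ]
    [MeasurableSpace X] (D : Measure X) [IsProbabilityMeasure D] :
    MeasurePreserving (Function.curry : (ι × κ → X) → ι → κ → X) (Measure.pi fun _ => D)
      (Measure.pi fun _ => Measure.pi fun _ => D) where
  measurable := measurable_curry
  map_eq := by
    have h := Measure.infinitePi_map_curry (fun (_ : ι) (_ : κ) => D)
    simpa only [Measure.infinitePi_eq_pi, MeasurableEquiv.coe_curry] using h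

/-- The probability that each of `L` agents fails to value all items of each of `L` disjoint
sets in `H`. -/
theorem utilityLaw_forall_not_forall_mem {D : Measure ℝ} [IsProbabilityMeasure D] {n m L r : ℕ}
    {ψ : Fin L → Fin n} (hψ : Function.Injective ψ) {φ : Fin L × Fin r → Fin m}
    (hφ : Function.Injective φ) {H : Set ℝ} (hH : MeasurableSet H) :
    utilityLaw D n m {u | ∀ k l, ¬ ∀ a, u (ψ k) (φ (l, a)) ∈ H} = (1 - D H ^ r) ^ (L * L) := by
  set V : Set (Fin L → Fin r → ℝ) := Set.univ.pi fun _ => (Set.univ.pi fun _ => H)ᶜ with hV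
  have hB : MeasurableSet (Set.univ.pi fun _ : Fin r => H) := MeasurableSet.univ_pi fun _ => hH
  have hVm : MeasurableSet V := MeasurableSet.univ_pi fun _ => hB.compl
  have h2 := (measurePreserving_pi_curry D (ι := Fin L) (κ := Fin r)).comp
    (measurePreserving_pi_comp_injective D hφ)
  have h3 := measurePreserving_pi_comp_injective (Measure.pi fun _ : Fin m => D) hψ
  have hW := h2.measurable hVm
  have e : {u : UtilityProfile n m | ∀ k l, ¬ ∀ a, u (ψ k) (φ (l, a)) ∈ H} =
      (fun (u : UtilityProfile n m) k => u (ψ k)) ⁻¹' (Set.univ.pi fun _ =>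
        (Function.curry ∘ fun (w : Fin m → ℝ) p => w (φ p)) ⁻¹' V) := by
    ext u
    simp [hV, Set.mem_pi, Function.curry]
  rw [e, utilityLaw, h3.measure_preimage (MeasurableSet.univ_pi fun _ => hW).nullMeasurableSet,
    Measure.pi_pi, h2.measure_preimage hVm.nullMeasurableSet, hV, Measure.pi_pi]
  simp [prob_compl_eq_one_sub hB, Measure.pi_pi, pow_mul]

/-- If `m` is far from the multiples of `n`, many bundles have at most `q` items, and many disjoint
sets of `q + 1` items lie inside one bundle. -/
theorem exists_small_bundles_and_chunks {n m q L : ℕ} (h1 : q * n + L * (q + 1) ≤ m)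
    (h2 : m + L * (q + 1) ≤ (q + 1) * n) (A : Allocation n m) :
    ∃ (ψ : Fin L → Fin n) (φ : Fin L × Fin (q + 1) → Fin m) (o : Fin L → Fin n),
      Function.Injective ψ ∧ Function.Injective φ ∧
      (∀ k, (Finset.univ.filter fun j => A j = ψ k).card ≤ q) ∧ ∀ l a, A (φ (l, a)) = o l := by
  classical
  set s : Fin n → ℕ := fun i => (Finset.univ.filter fun j => A j = i).card with hs
  have hsum : ∑ i, s i = m := by
    have := Finset.card_eq_sum_card_fiberwise (s := Finset.univ) (t := Finset.univ) (f := A)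
      fun _ _ => Finset.mem_coe.2 (Finset.mem_univ _)
    simpa using this.symm
  -- A bundle with more than `q` items has at least `q + 1`, so only small bundles account for the
  -- deficit `(q + 1) n - m`.
  have hsmall : L ≤ (Finset.univ.filter fun i => s i ≤ q).card := by
    have : (q + 1) * n ≤ m + (Finset.univ.filter fun i => s i ≤ q).card * (q + 1) := by
      calc (q + 1) * n = ∑ _i : Fin n, (q + 1) := by simp [mul_comm]
        _ ≤ ∑ i, (s i + if s i ≤ q then q + 1 else 0) := by
            refine Finset.sum_le_sum fun i _ => ?_
            split_ifs <;> omega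
        _ = _ := by
            rw [Finset.sum_add_distrib, hsum, ← Finset.sum_filter, Finset.sum_const, smul_eq_mul]
    exact Nat.le_of_mul_le_mul_right (by omega) q.add_one_pos
  -- Cutting a bundle into chunks wastes at most `q` items.
  have hchunk : L ≤ ∑ i, s i / (q + 1) := by
    have : m ≤ q * n + (∑ i, s i / (q + 1)) * (q + 1) := by
      calc m = ∑ i, s i := hsum.symm
        _ ≤ ∑ i, (q + s i / (q + 1) * (q + 1)) := by
            refine Finset.sum_le_sum fun i _ => ?_
            have := Nat.mod_add_div' (s i) (q + 1)
            have := Nat.mod_lt (s i) q.add_one_pos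
            omega
        _ = _ := by rw [Finset.sum_add_distrib, Finset.sum_mul]; simp [mul_comm]
    exact Nat.le_of_mul_le_mul_right (by omega) q.add_one_pos
  obtain ⟨ψ⟩ : Nonempty (Fin L ↪ {i // s i ≤ q}) := by
    rw [Function.Embedding.nonempty_iff_card_le, Fintype.card_fin, Fintype.card_subtype]
    exact hsmall
  obtain ⟨f⟩ : Nonempty (Fin L ↪ Σ i, Fin (s i / (q + 1))) := by
    rw [Function.Embedding.nonempty_iff_card_le, Fintype.card_fin, Fintype.card_sigma]
    simpa using hchunk
  have hg (i : Fin n) : Nonempty (Fin (s i / (q + 1)) × Fin (q + 1) ↪ {j // A j = i}) := by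
    rw [Function.Embedding.nonempty_iff_card_le, Fintype.card_subtype]
    simpa using Nat.div_mul_le_self (s i) (q + 1)
  let g i := (hg i).some
  refine ⟨fun k => ψ k, fun p => g (f p.1).1 ((f p.1).2, p.2), fun l => (f l).1,
    Subtype.val_injective.comp ψ.injective, ?_, fun k => (ψ k).2, fun l a => (g _ _).2⟩
  rintro ⟨l, a⟩ ⟨l', a'⟩ h
  have hG : Function.Injective fun x : (Σ i, Fin (s i / (q + 1)) × Fin (q + 1)) =>
      ((g x.1 x.2 : {j // A j = x.1}) : Fin m) := by
    rintro ⟨i, x⟩ ⟨i', x'⟩ hx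
    have hi : i = i' := by
      have h1 := (g i x).2
      have h2 := (g i' x').2
      rw [← h1, ← h2]
      exact congrArg A hx
    subst hi
    exact congrArg (Sigma.mk i) ((g i).injective (Subtype.ext hx))
  have := @hG ⟨(f l).1, ((f l).2, a)⟩ ⟨(f l').1, ((f l').2, a')⟩ h
  have := congrArg (fun x : (Σ i, Fin (s i / (q + 1)) × Fin (q + 1)) =>
    ((⟨x.1, x.2.1⟩ : Σ i, Fin (s i / (q + 1))), x.2.2)) this
  simp only [Sigma.eta, Prod.mk.injEq, EmbeddingLike.apply_eq_iff_eq] at this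
  rw [this.1, this.2]

/-- A bundle of `q` items is worth at most `q`, while `q + 1` items each above `1 - 1/(q+1)` are
worth more than `q`. -/
theorem not_forall_gt_of_envyFree {n m q L : ℕ} {u : UtilityProfile n m}
    (hu : ∀ i j, u i j ∈ Set.Icc (0 : ℝ) 1) {A : Allocation n m} (hA : EnvyFree u A)
    {φ : Fin L × Fin (q + 1) → Fin m} (hφ : Function.Injective φ) {i k : Fin n}
    (hi : (Finset.univ.filter fun j => A j = i).card ≤ q) {l : Fin L}
    (hk : ∀ a, A (φ (l, a)) = k) :
    ¬ ∀ a, u i (φ (l, a)) ∈ Set.Ioi (1 - 1 / ((q + 1 : ℕ) : ℝ)) := by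
  intro h
  have h1 : bundleUtility u A i i ≤ q := by
    refine (Finset.sum_le_card_nsmul _ _ 1 fun j _ => (hu i j).2).trans ?_
    rw [nsmul_one]
    exact_mod_cast hi
  have h2 : ∑ a, u i (φ (l, a)) ≤ bundleUtility u A i k := by
    have hinj : Function.Injective fun a => φ (l, a) := hφ.comp (Prod.mk_right_injective l)
    rw [← Finset.sum_image (f := fun j => u i j) hinj.injOn]
    refine Finset.sum_le_sum_of_subset_of_nonneg ?_ fun j _ _ => (hu i j).1
    intro j hj
    obtain ⟨a, _, rfl⟩ := Finset.mem_image.1 hj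
    simp [hk]
  have h3 : ∑ _a : Fin (q + 1), (1 - 1 / ((q + 1 : ℕ) : ℝ)) < ∑ a, u i (φ (l, a)) :=
    Finset.sum_lt_sum_of_nonempty Finset.univ_nonempty fun a _ => h a
  rw [Finset.sum_const, Finset.card_univ, Fintype.card_fin, nsmul_eq_mul, mul_sub,
    mul_one_div_cancel (by positivity)] at h3
  have := hA i k
  push_cast at h3
  linarith

/-- Only `ψ` and `φ` are enumerated: the exponent of the number of choices is linear in `L`, that of
the probability quadratic. -/
theorem utilityLaw_exists_envyFree_le {α β : ℝ} {D : Measure ℝ} (hD : IsPDFBounded α β D)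
    (hα : 0 < α) {n m q L : ℕ} (h1 : q * n + L * (q + 1) ≤ m)
    (h2 : m + L * (q + 1) ≤ (q + 1) * n) :
    utilityLaw D n m {u | ∃ A : Allocation n m, EnvyFree u A} ≤
      ENNReal.ofReal ((n : ℝ) ^ L * (m : ℝ) ^ (L * (q + 1)) *
        Real.exp (-((α / (q + 1)) ^ (q + 1) * (L * L)))) := by
  classical
  have := hD.1
  set μ := utilityLaw D n m with hμ
  set H := Set.Ioi (1 - 1 / ((q + 1 : ℕ) : ℝ)) with hH
  set bad : (Fin L → Fin n) → (Fin L × Fin (q + 1) → Fin m) → Set (UtilityProfile n m) :=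
    fun ψ φ => {u | (Function.Injective ψ ∧ Function.Injective φ) ∧
      ∀ k l, ¬ ∀ a, u (ψ k) (φ (l, a)) ∈ H} with hbad
  set N : Set (UtilityProfile n m) := {u | ¬ ∀ i j, u i j ∈ Set.Icc (0 : ℝ) 1} with hN
  have hcover : {u | ∃ A : Allocation n m, EnvyFree u A} ⊆ N ∪ ⋃ ψ, ⋃ φ, bad ψ φ := by
    rintro u ⟨A, hA⟩
    by_cases hu : ∀ i j, u i j ∈ Set.Icc (0 : ℝ) 1
    · obtain ⟨ψ, φ, o, hψ, hφ, hs, ho⟩ := exists_small_bundles_and_chunks h1 h2 A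
      refine Or.inr (Set.mem_iUnion₂.2 ⟨ψ, φ, ⟨hψ, hφ⟩, fun k l => ?_⟩)
      exact not_forall_gt_of_envyFree hu hA hφ (hs k) (ho l)
    · exact Or.inl hu
  have hN0 : μ N = 0 := ae_iff.1 (ae_utilityLaw_mem_Icc hD n m)
  set δ : ℝ := (α / (q + 1)) ^ (q + 1) with hδ
  have hDH : ENNReal.ofReal δ ≤ D H ^ (q + 1) := by
    rw [hδ, ENNReal.ofReal_pow (by positivity)]
    gcongr
    have hq : (1 : ℝ) / ((q + 1 : ℕ) : ℝ) ≤ 1 := by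
      rw [div_le_one (by positivity)]; push_cast; linarith [(Nat.cast_nonneg q : (0 : ℝ) ≤ q)]
    have h := hD.ofReal_mul_le hα.le (s := 1 - 1 / ((q + 1 : ℕ) : ℝ)) (t := 1) (by linarith) le_rfl
    refine le_trans (le_of_eq ?_) (h.trans (measure_mono Set.Ioo_subset_Ioi_self))
    congr 1
    push_cast
    ring
  have hbadi (ψ : Fin L → Fin n) (φ : Fin L × Fin (q + 1) → Fin m) :
      μ (bad ψ φ) ≤ ENNReal.ofReal (Real.exp (-(δ * (L * L)))) := by
    by_cases hinj : Function.Injective ψ ∧ Function.Injective φ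
    · calc μ (bad ψ φ) ≤ μ {u | ∀ k l, ¬ ∀ a, u (ψ k) (φ (l, a)) ∈ H} :=
            measure_mono fun u hu => hu.2
        _ = (1 - D H ^ (q + 1)) ^ (L * L) :=
            utilityLaw_forall_not_forall_mem hinj.1 hinj.2 measurableSet_Ioi
        _ ≤ (ENNReal.ofReal (Real.exp (-δ))) ^ (L * L) := by
            gcongr
            calc 1 - D H ^ (q + 1) ≤ 1 - ENNReal.ofReal δ := by gcongr
              _ = ENNReal.ofReal (1 - δ) := by
                rw [ENNReal.ofReal_sub _ (by positivity), ENNReal.ofReal_one]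
              _ ≤ _ := ENNReal.ofReal_le_ofReal (by linarith [Real.add_one_le_exp (-δ)])
        _ = _ := by
            rw [← ENNReal.ofReal_pow (Real.exp_pos _).le, ← Real.exp_nat_mul]
            congr 2
            push_cast
            ring
    · have : bad ψ φ = ∅ := by ext u; simp [hbad, hinj]
      simp [this]
  calc _ ≤ μ N + μ (⋃ ψ, ⋃ φ, bad ψ φ) := (measure_mono hcover).trans (measure_union_le _ _)
    _ ≤ 0 + ∑ ψ, ∑ φ, μ (bad ψ φ) := by
        rw [hN0]
        gcongr
        exact (measure_iUnion_fintype_le μ _).trans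
          (Finset.sum_le_sum fun ψ _ => measure_iUnion_fintype_le μ _)
    _ ≤ 0 + ∑ _ψ : Fin L → Fin n, ∑ _φ : Fin L × Fin (q + 1) → Fin m,
          ENNReal.ofReal (Real.exp (-(δ * (L * L)))) := by
        gcongr with ψ _ φ _
        exact hbadi ψ φ
    _ = (n : ENNReal) ^ L * (m : ENNReal) ^ (L * (q + 1)) *
          ENNReal.ofReal (Real.exp (-(δ * (L * L)))) := by
        simp [mul_assoc]
    _ = _ := by
        rw [ENNReal.ofReal_mul (by positivity), ENNReal.ofReal_mul (by positivity),
          ENNReal.ofReal_pow (by positivity), ENNReal.ofReal_pow (by positivity),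
          ENNReal.ofReal_natCast, ENNReal.ofReal_natCast]

/-! ### Asymptotics for nonexistence -/

theorem eventually_logb_pow_le_rpow {s : ℝ} (hs : 0 < s) :
    ∀ᶠ n : ℕ in atTop, Real.logb 2 n ^ 3 + 1 ≤ (n : ℝ) ^ s := by
  have h := (isLittleO_log_rpow_rpow_atTop 3 hs).const_mul_left (2 / Real.log 2 ^ 3)
  filter_upwards [tendsto_natCast_atTop_atTop.eventually (h.bound one_pos),
    tendsto_logb_two_natCast.eventually_ge_atTop 1] with n hn h1
  rw [one_mul, Real.norm_of_nonneg (show (0 : ℝ) ≤ (n : ℝ) ^ s by positivity)] at hn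
  have e : 2 / Real.log 2 ^ 3 * Real.log n ^ (3 : ℝ) = 2 * Real.logb 2 n ^ 3 := by
    rw [Real.logb]; norm_cast; ring
  have h2 := (le_abs_self _).trans hn
  rw [e] at h2
  have := one_le_pow₀ h1 (n := 3)
  linarith

/-- If `m ≤ (ε / 16) rate n`, then `δ = (α / r) ^ r` with `r = m / n + 1` is not too small. -/
theorem eventually_rounds_bound {α ε : ℝ} (hα : 0 < α) (hε : 0 < ε) {m : ℕ → ℕ}
    (hm : ∀ᶠ n : ℕ in atTop, (m n : ℝ) ≤ ε / 16 * rate n) :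
    ∀ᶠ n : ℕ in atTop, ((m n / n : ℕ) : ℝ) + 1 ≤ Real.logb 2 n ^ 2 / 4 ∧
      (n : ℝ) ^ (-(ε / 4)) ≤ (α / ((m n / n : ℕ) + 1)) ^ (m n / n + 1) := by
  have hL := tendsto_logb_two_natCast
  filter_upwards [hm, eventually_gt_atTop 0, hL.eventually_gt_atTop 2,
    hL.eventually (eventually_mul_logb_le_rpow (16 / ε) (s := 1) (by norm_num)),
    hL.eventually (eventually_mul_logb_le_rpow 1 (s := 1) (by norm_num)),
    hL.eventually_ge_atTop (ε / 2), hL.eventually_ge_atTop (ε / 8 / α),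
    hL.eventually_ge_atTop 4] with n hmn hn h2 hεl h1 hL1 hL2 hL4
  rw [Real.rpow_one] at hεl
  rw [Real.rpow_one, one_mul] at h1
  have hn' : (0 : ℝ) < n := by exact_mod_cast hn
  have hlog2 : 0 < Real.log 2 := Real.log_pos (by norm_num)
  have e2 : Real.log n = Real.logb 2 n * Real.log 2 := by rw [Real.logb]; field_simp
  rw [rate] at hmn
  set L := Real.logb 2 n with hLdef
  have hL0 : 0 < L := by linarith
  have e1 : Real.log L = Real.logb 2 L * Real.log 2 := by rw [Real.logb]; field_simp
  set l := Real.logb 2 L with hl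
  have hl1 : 1 ≤ l := by
    rw [hl, Real.le_logb_iff_rpow_le (by norm_num) hL0, Real.rpow_one]; exact h2.le
  have hl0 : 0 < l := by linarith
  have hq : ((m n / n : ℕ) : ℝ) ≤ ε / 16 * (L / l) := by
    refine Nat.cast_div_le.trans ?_
    rw [div_le_iff₀ hn']
    refine hmn.trans (le_of_eq ?_)
    ring
  -- This absorbs the `+ 1` of `r = q + 1`, doubling `ε / 16` to `ε / 8`. The bound `log (r/α) ≤ 2
  -- log L` below doubles it again, to the exponent `ε / 4`.
  have h16 : 1 ≤ ε / 16 * (L / l) := by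
    rw [div_mul_div_comm, one_le_div (by positivity)]
    rw [div_mul_eq_mul_div, div_le_iff₀ hε] at hεl
    linarith
  set q := m n / n
  have hr : (q : ℝ) + 1 ≤ ε / 8 * (L / l) := by linarith
  have hLl : L / l ≤ L := div_le_self hL0.le hl1
  have hr' : (q : ℝ) + 1 ≤ ε / 8 * L := hr.trans (by gcongr)
  have hr0 : (0 : ℝ) < q + 1 := by positivity
  refine ⟨hr'.trans (by nlinarith), ?_⟩
  have hx : ((q : ℝ) + 1) / α ≤ L ^ 2 := by
    calc ((q : ℝ) + 1) / α ≤ ε / 8 * L / α := by gcongr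
      _ = ε / 8 / α * L := by ring
      _ ≤ L * L := by gcongr
      _ = _ := by ring
  have hlog : Real.log (((q : ℝ) + 1) / α) ≤ 2 * (l * Real.log 2) := by
    calc _ ≤ Real.log (L ^ 2) := Real.log_le_log (by positivity) hx
      _ = _ := by rw [Real.log_pow, e1]; norm_num
  have hinv : α / ((q : ℝ) + 1) = Real.exp (-Real.log (((q : ℝ) + 1) / α)) := by
    rw [Real.exp_neg, Real.exp_log (by positivity), inv_div]
  rw [hinv, ← Real.exp_nat_mul, Real.rpow_def_of_pos hn']
  refine Real.exp_le_exp.2 ?_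
  push_cast
  have : ((q : ℝ) + 1) * Real.log (((q : ℝ) + 1) / α) ≤ ε / 4 * Real.log n := by
    calc _ ≤ ((q : ℝ) + 1) * (2 * (l * Real.log 2)) := by gcongr
      _ ≤ ε / 8 * (L / l) * (2 * (l * Real.log 2)) := by gcongr
      _ = _ := by rw [e2]; field_simp; ring
  linarith

/-- The offsets `m % n` and `m % n - n` both lead to multiples of `n`, so both must be large. -/
theorem AwayFromMultiples.eventually_lt {ε : ℝ} {m : ℕ → ℕ} (h : AwayFromMultiples ε m) :
    ∀ᶠ n : ℕ in atTop, (n : ℝ) ^ ε < (m n % n : ℕ) ∧ (n : ℝ) ^ ε < n - (m n % n : ℕ) := by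
  filter_upwards [h, eventually_gt_atTop 0] with n hn hpos
  have hlt : ((m n % n : ℕ) : ℝ) < n := by exact_mod_cast Nat.mod_lt _ hpos
  have hd : (n : ℤ) ∣ (m n : ℤ) - (m n % n : ℕ) := by
    push_cast
    exact Int.dvd_self_sub_emod
  constructor
  · by_contra hc
    push Not at hc
    refine hn (m n % n : ℕ) ?_ hd
    rwa [Int.cast_natCast, Nat.abs_cast]
  · by_contra hc
    push Not at hc
    refine hn ((m n % n : ℕ) - n) ?_ ?_
    · rw [Int.cast_sub, Int.cast_natCast, Int.cast_natCast, abs_of_nonpos (by linarith)]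
      linarith
    · have : (m n : ℤ) - ((m n % n : ℕ) - n) = (m n : ℤ) - (m n % n : ℕ) + n := by ring
      rw [this]
      exact hd.add dvd_rfl

theorem tendsto_utilityLaw_exists_envyFree {α β ε : ℝ} (hα : 0 < α) (hε : 0 < ε)
    {D : Measure ℝ} (hD : IsPDFBounded α β D) {m : ℕ → ℕ} (haway : AwayFromMultiples ε m)
    (hm : ∀ᶠ n : ℕ in atTop, (m n : ℝ) ≤ ε / 16 * rate n) :
    Tendsto (fun n : ℕ => utilityLaw D n (m n) {u | ∃ A : Allocation n (m n), EnvyFree u A})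
      atTop (𝓝 0) := by
  have hlim : Tendsto (fun n : ℕ => ENNReal.ofReal (Real.exp (-((n : ℝ) ^ (ε / 2))))) atTop
      (𝓝 0) := by
    rw [← ENNReal.ofReal_zero]
    exact ENNReal.tendsto_ofReal (Real.tendsto_exp_neg_atTop_nhds_zero.comp
      ((tendsto_rpow_atTop (half_pos hε)).comp tendsto_natCast_atTop_atTop))
  refine tendsto_of_tendsto_of_tendsto_of_le_of_le' tendsto_const_nhds hlim
    (Eventually.of_forall fun _ => zero_le) ?_
  filter_upwards [eventually_rounds_bound hα hε hm, haway.eventually_lt,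
    eventually_logb_pow_le_rpow (s := ε / 4) (by positivity),
    eventually_logb_pow_le_rpow (s := 1) one_pos, eventually_gt_atTop 0,
    tendsto_logb_two_natCast.eventually_ge_atTop 4] with n ⟨hr, hδ⟩ ⟨h1, h2⟩ hLε hLn hn hL4
  rw [Real.rpow_one] at hLn
  have hn' : (0 : ℝ) < n := by exact_mod_cast hn
  have hn1 : (1 : ℝ) ≤ n := by exact_mod_cast hn
  set q := m n / n
  set L := Real.logb 2 n with hL
  set N := (n : ℝ) ^ (ε / 4) with hN
  have hN1 : 1 ≤ N := Real.one_le_rpow hn1 (by positivity)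
  have e2 : (n : ℝ) ^ (ε / 2) = N ^ 2 := by
    rw [hN, ← Real.rpow_natCast, ← Real.rpow_mul hn'.le]; congr 1; push_cast; ring
  have e4 : (n : ℝ) ^ ε = N ^ 4 := by
    rw [hN, ← Real.rpow_natCast, ← Real.rpow_mul hn'.le]; congr 1; push_cast; ring
  have en : (n : ℝ) ^ (-(ε / 4)) = N⁻¹ := by rw [Real.rpow_neg hn'.le]
  rw [e4] at h1 h2
  rw [en] at hδ
  rw [e2]
  -- `K`, about `n^(ε/2)`, is the number of agents and of chunks: small enough for `K (q + 1) ≤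
  -- n^ε`, large enough for `δ K ≥ N = n^(ε/4)`, which beats `q log n`.
  set K := ⌈N ^ 2⌉₊ with hK
  have hKl : N ^ 2 ≤ K := Nat.le_ceil _
  have hKu : (K : ℝ) ≤ 2 * N ^ 2 := by
    have := Nat.ceil_lt_add_one (show 0 ≤ N ^ 2 by positivity)
    have := one_le_pow₀ hN1 (n := 2)
    linarith
  have hrN : 2 * ((q : ℝ) + 1) ≤ N := by nlinarith
  have hKr : (K : ℝ) * (q + 1) ≤ N ^ 4 := by
    calc (K : ℝ) * (q + 1) ≤ 2 * N ^ 2 * (N / 2) := by gcongr; linarith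
      _ = N ^ 3 := by ring
      _ ≤ N ^ 4 := pow_le_pow_right₀ hN1 (by norm_num)
  have hdm := Nat.div_add_mod (m n) n
  have hdm' : (m n : ℝ) = n * q + (m n % n : ℕ) := by exact_mod_cast hdm.symm
  have hA : q * n + K * (q + 1) ≤ m n := by
    have : (q : ℝ) * n + K * (q + 1) ≤ m n := by linarith
    exact_mod_cast this
  have hB : m n + K * (q + 1) ≤ (q + 1) * n := by
    have : (m n : ℝ) + K * (q + 1) ≤ (q + 1) * n := by linarith
    exact_mod_cast this
  refine (utilityLaw_exists_envyFree_le hD hα hA hB).trans (ENNReal.ofReal_le_ofReal ?_)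
  have hmn : (m n : ℝ) ≤ (n : ℝ) ^ 2 := by
    have h3 : (m n : ℝ) ≤ (q + 1) * n := by
      have : (0 : ℝ) ≤ K * (q + 1) := by positivity
      have : (m n : ℝ) + K * (q + 1) ≤ (q + 1) * n := by exact_mod_cast hB
      linarith
    have h4 : (q : ℝ) + 1 ≤ n := by nlinarith
    nlinarith
  have hlogn : Real.log n ≤ L := by
    rw [hL, Real.logb, le_div_iff₀ (Real.log_pos (by norm_num))]
    have h5 := Real.log_two_lt_d9
    have h6 := Real.log_nonneg hn1
    nlinarith
  have hdelta : N ≤ (α / (q + 1)) ^ (q + 1) * K := by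
    calc N = N⁻¹ * N ^ 2 := by field_simp
      _ ≤ _ := by gcongr
  calc (n : ℝ) ^ K * (m n : ℝ) ^ (K * (q + 1)) *
        Real.exp (-((α / (q + 1)) ^ (q + 1) * (K * K)))
      ≤ (n : ℝ) ^ K * ((n : ℝ) ^ 2) ^ (K * (q + 1)) *
        Real.exp (-((α / (q + 1)) ^ (q + 1) * (K * K))) := by gcongr
    _ = Real.exp (K * ((2 * (q + 1) + 1) * Real.log n - (α / (q + 1)) ^ (q + 1) * K)) := by
        rw [← pow_mul, ← pow_add]
        nth_rewrite 1 [← Real.exp_log hn']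
        rw [← Real.exp_nat_mul, ← Real.exp_add]
        congr 1
        push_cast
        ring
    _ ≤ Real.exp (-(N ^ 2)) := by
        refine Real.exp_le_exp.2 ?_
        have h7 : (2 * ((q : ℝ) + 1) + 1) * Real.log n ≤ N - 1 := by
          calc (2 * ((q : ℝ) + 1) + 1) * Real.log n ≤ L ^ 2 * L := by
                have : (0 : ℝ) ≤ q := by positivity
                have h10 : 2 * ((q : ℝ) + 1) + 1 ≤ L ^ 2 := by linarith
                have := Real.log_nonneg hn1
                gcongr
            _ ≤ N - 1 := by linarith
        -- The bracket is at most `-1`, so the exponent is at most `-K ≤ -N²`.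
        have h8 : (2 * ((q : ℝ) + 1) + 1) * Real.log n - (α / (q + 1)) ^ (q + 1) * K ≤ -1 := by
          linarith
        have h9 : (0 : ℝ) ≤ K := by positivity
        nlinarith

theorem theorem3p1 (α β : ℝ) (hα : 0 < α) (hβ : 0 < β) :
    (∃ C : ℝ, 0 < C ∧
      ∀ D : Measure ℝ, IsPDFBounded α β D →
      ∀ m : ℕ → ℕ, (∀ᶠ n : ℕ in atTop, C * rate n ≤ (m n : ℝ)) →
        Tendsto (fun n : ℕ => utilityLaw D n (m n)
            {u | ∀ A : Allocation n (m n), IsRoundRobinOutput u A → EnvyFree u A})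
          atTop (𝓝 1)) ∧
    (∀ ε : ℝ, 0 < ε → ∃ c : ℝ, 0 < c ∧
      ∀ D : Measure ℝ, IsPDFBounded α β D →
      ∀ m : ℕ → ℕ, AwayFromMultiples ε m →
        (∀ᶠ n : ℕ in atTop, (m n : ℝ) ≤ c * rate n) →
        Tendsto (fun n : ℕ => utilityLaw D n (m n)
            {u | ∃ A : Allocation n (m n), EnvyFree u A})
          atTop (𝓝 0)) :=
  ⟨⟨72 / α, by positivity, fun _ hD _ hm => tendsto_utilityLaw_roundRobin_envyFree hα hβ hD hm⟩,
    fun ε hε => ⟨ε / 16, by positivity, fun _ hD _ haway hm =>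
      tendsto_utilityLaw_exists_envyFree hα hε hD haway hm⟩⟩
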